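/- Let $\Bbbk$ be a field and let $(\mathcal{C},\mathbb{E},\mathfrak{s},\mathbb{E}^{-1})$ be a $\Bbbk$-linear Krull–Schmidt extriangulated category (in the sense of Nakaoka–Palu) with a negative first extension. That is, $\mathbb{E}^{-1}:\mathcal{C}^{\mathrm{op}}\times\mathcal{C}\to\mathcal{A}b$ is an additive bifunctor, and each $\delta\in\mathbb{E}(C,A)$ comes with natural transformations $\mathbb{E}^{-1}(-,C)\to\mathcal{C}(-,A)$ and $\mathbb{E}^{-1}(A,-)\to\mathcal{C}(C,-)$ such that, for every $\mathfrak{s}$-conflation $A\to B\to C\overset{\delta}{\dashrightarrow}$ and every $W\in\mathcal{C}$, the sequences $\mathbb{E}^{-1}(W,A)\to\mathbb{E}^{-1}(W,B)\to\mathbb{E}^{-1}(W,C)\to\mathcal{C}(W,A)\to\mathcal{C}(W,B)$ and $\mathbb{E}^{-1}(C,W)\to\mathbb{E}^{-1}(B,W)\to\mathbb{E}^{-1}(A,W)\to\mathcal{C}(C,W)\to\mathcal{C}(B,W)$ are exact. All subcategories are full and closed under isomorphisms. **Notation.** An object is a *brick* if its endomorphism ring is a division ring, and a *stone* if it is indecomposable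 and $\mathbb{E}(N,N)=0$. For $M\in\mathcal{C}$, $\mathsf{add}\,M$ is the subcategory of direct summands of finite direct sums of copies of $M$; $\mathcal{X}*\mathcal{Y}$ is the subcategory of objects $Z$ admitting an $\mathfrak{s}$-conflation $X\to Z\to Y\dashrightarrow$ with $X\in\mathcal{X}$, $Y\in\mathcal{Y}$; and $\mathcal{F}(M)=\bigcup_{l>0}\mathsf{add}\,M*\cdots*\mathsf{add}\,M$ ($l$ factors). A subcategory $\mathcal{E}$ is *extension-closed* if $\mathcal{E}*\mathcal{E}\subseteq\mathcal{E}$ and *$\mathbb{E}$-finite* if $\dim_\Bbbk\mathbb{E}(M,N)<\infty$ for all $M,N\in\mathcal{E}$. Put ${}^{\perp_{\mathbb{E}}}\mathcal{X}=\{M\mid\mathbb{E}(M,\mathcal{X})=0\}$ and $\mathcal{X}^{\perp_{\mathcal{C}}}=\{M\mid\mathcal{C}(\mathcal{X},M)=0\}$. A morphism $\alpha:P\to M$ is *right minimal* if every $\varphi:P\to P$ with $\alpha\varphi=\alpha$ is an isomorphism. For an object $N$ let $D_N=\operatorname{End}_{\mathcal{C}}(N)^{\mathrm{op}}$ if $N$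 is a brick and $D_N=\Bbbk$ otherwise; $\mathbb{E}(M,N)$ is a right $D_N$-module. If it is finite-dimensional with basis $\delta_1,\dots,\delta_d$, a *universal extension of $M$ by $N$* is an $\mathfrak{s}$-conflation $N^{\oplus d}\to P\to M\overset{\delta}{\dashrightarrow}$ where $\delta\in\mathbb{E}(M,N^{\oplus d})$ has components $\delta_1,\dots,\delta_d$ (for $d=0$ it is $0\to M\xrightarrow{1}M$). Iterating gives a sequence $\cdots\to P_2\xrightarrow{a_2}P_1\xrightarrow{a_1}P_0=M$, where each $a_s$ is the deflation of a universal extension of $P_{s-1}$ by $N$. An extension-closed subcategory $\mathcal{E}\ni N$ *admits a finite sequence of universal extensions by $N$* if for every $M\in\mathcal{E}$ some $a_s$ with $s\ge1$ is an isomorphism. **Assumptions.** Let $\Theta=(\Theta(1),\dots,\Theta(t))$ be an ordered set of objects of $\mathcal{C}$, also regarded as the object $\Theta(1)\oplus\cdots\oplus\Theta(t)$, such that - (MS1) each $\Theta(i)$ is a brick or a stone; - (MS2) $\mathcal{C}(\Theta(i),\Theta(j))=0$ for $i>j$; - (MS3) $\mathbb{E}(\Theta(i),\Theta(j))=0$ for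 $i>j$. Put $\mathcal{F}(\Theta(\ge j))=\mathcal{F}(\Theta(j)\oplus\cdots\oplus\Theta(t))$. Let $\mathcal{E}$ be an $\mathbb{E}$-finite extension-closed subcategory of $\mathcal{C}$ which contains every $\Theta(i)$ and admits a finite sequence of universal extensions by each $\Theta(i)$. **Proposition.** For each $M\in\mathcal{E}$ the following hold. 1. There is an $\mathfrak{s}$-conflation $K\to P\xrightarrow{\alpha_M}M\dashrightarrow$ such that $P\in{}^{\perp_{\mathbb{E}}}\mathcal{F}(\Theta)\cap\mathcal{E}$ and $\alpha_M$ is right minimal. Moreover, $K=0$ if $M\in{}^{\perp_{\mathbb{E}}}\mathcal{F}(\Theta)$, and $K\in\mathcal{F}(\Theta(\ge j))$ if $M\notin{}^{\perp_{\mathbb{E}}}\mathcal{F}(\Theta)$, where $j$ is the minimum value with $\mathbb{E}(M,\Theta(j))\ne0$. 2. Assume in addition that $\mathbb{E}^{-1}(\Theta,\Theta)=0$ (so $\Theta$ is a *mixed standardizable set*) and $\mathcal{E}=\mathcal{F}(\Theta)$. If $M\notin{}^{\perp_{\mathbb{E}}}\mathcal{F}(\Theta)$ is indecomposable and lies in $\mathcal{F}(\Theta(\ge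 j))^{\perp_{\mathcal{C}}}$ or in $\mathsf{add}\,\Theta(j)$, with $j$ as in (1), then for every $\mathfrak{s}$-conflation as in (1) the object $P$ is indecomposable. -/

import Mathlib

open CategoryTheory CategoryTheory.Limits Opposite

universe v u w w' z

namespace MixedStd

section Extriangulated

variable (𝕜 : Type z) [Field 𝕜] (C : Type u) [Category.{v} C] [Preadditive C]
  [Linear 𝕜 C] [HasFiniteBiproducts C] [HasBinaryBiproducts C]

variable {C} in
/-- A sequence `A ⟶ B ⟶ C'` with prescribed ends. -/
structure Seq (A C' : C) where
  /-- the middle term -/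
  B : C
  /-- the first map -/
  f : A ⟶ B
  /-- the second map -/
  g : B ⟶ C'

variable {C} in
/-- Two sequences with the same ends are equivalent if there is an isomorphism between the
middle terms compatible with the maps. -/
instance Seq.setoid (A C' : C) : Setoid (Seq A C') where
  r S S' := ∃ b : S.B ≅ S'.B, S.f ≫ b.hom = S'.f ∧ b.hom ≫ S'.g = S.g
  iseqv :=
    { refl := fun S => ⟨Iso.refl _, by simp, by simp⟩
      symm := by
        rintro S S' ⟨b, h₁, h₂⟩
        exact ⟨b.symm, by simp [← h₁], by simp [← h₂]⟩
      trans := by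
        rintro S S' S'' ⟨b, h₁, h₂⟩ ⟨b', h₁', h₂'⟩
        exact ⟨b ≪≫ b', by simp [← h₁', ← h₁], by simp [← h₂, ← h₂']⟩ }

/-- The data of a `𝕜`-linear extriangulated category: a `𝕜`-bilinear bifunctor
`𝔼 : Cᵒᵖ × C → Mod 𝕜` and a correspondence `𝔰` that assigns to each `δ ∈ 𝔼(C', A)` an
equivalence class of sequences `A ⟶ B ⟶ C'`. -/
structure ExtData where
  /-- the bifunctor `𝔼` -/
  E : Cᵒᵖ ⥤ C ⥤ ModuleCat.{w} 𝕜
  map_right_add : ∀ (X : Cᵒᵖ) {A A' : C} (a b : A ⟶ A'),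
    (E.obj X).map (a + b) = (E.obj X).map a + (E.obj X).map b
  map_right_smul : ∀ (X : Cᵒᵖ) {A A' : C} (r : 𝕜) (a : A ⟶ A'),
    (E.obj X).map (r • a) = r • (E.obj X).map a
  map_left_add : ∀ (A : C) {X X' : C} (a b : X ⟶ X'),
    (E.map (a + b).op).app A = (E.map a.op).app A + (E.map b.op).app A
  map_left_smul : ∀ (A : C) {X X' : C} (r : 𝕜) (a : X ⟶ X'),
    (E.map (r • a).op).app A = r • (E.map a.op).app A
  /-- the correspondence `𝔰` -/
  s : ∀ {C' A : C}, ((E.obj (op C')).obj A) → Quotient (Seq.setoid A C')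

variable {𝕜 C}

namespace ExtData

variable (X : ExtData.{v, u, w, z} 𝕜 C)

/-- The `𝕜`-module `𝔼(C', A)`. -/
abbrev Ext (C' A : C) : Type w := (X.E.obj (op C')).obj A

/-- `a_* = 𝔼(C', a) : 𝔼(C', A) → 𝔼(C', A')`. -/
def push {C' A A' : C} (a : A ⟶ A') : X.Ext C' A →ₗ[𝕜] X.Ext C' A' :=
  ((X.E.obj (op C')).map a).hom

/-- `c^* = 𝔼(c, A) : 𝔼(C', A) → 𝔼(C'', A)`. -/
def pull {C'' C' A : C} (c : C'' ⟶ C') : X.Ext C' A →ₗ[𝕜] X.Ext C'' A :=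
  ((X.E.map c.op).app A).hom

/-- `𝔰(δ) = [A ⟶ B ⟶ C']`, i.e. `A ⟶ B ⟶ C' ⇢` is the `𝔰`-conflation given by `δ`. -/
def Realizes {A B C' : C} (δ : X.Ext C' A) (f : A ⟶ B) (g : B ⟶ C') : Prop :=
  X.s δ = Quotient.mk (Seq.setoid A C') ⟨B, f, g⟩

/-- `A ⟶ B ⟶ C'` is an `𝔰`-conflation. -/
def IsConflation {A B C' : C} (f : A ⟶ B) (g : B ⟶ C') : Prop :=
  ∃ δ : X.Ext C' A, X.Realizes δ f g

/-- The extension `δ ⊕ δ' ∈ 𝔼(C₁ ⊕ C₂, A₁ ⊕ A₂)` with components `(δ, 0, 0, δ')`. -/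
noncomputable def directSum {A₁ A₂ C₁ C₂ : C} (δ : X.Ext C₁ A₁) (δ' : X.Ext C₂ A₂) :
    X.Ext (C₁ ⊞ C₂) (A₁ ⊞ A₂) :=
  X.push biprod.inl (X.pull biprod.fst δ) + X.push biprod.inr (X.pull biprod.snd δ')

end ExtData

variable (𝕜 C) in
/-- A `𝕜`-linear extriangulated structure on `C` (Nakaoka--Palu): (ET1) is contained in
`ExtData`; `realize`, `realize_zero` and `realize_sum` say that `𝔰` is an additive realization
(ET2); the other fields are (ET3), (ET3)ᵒᵖ, (ET4), (ET4)ᵒᵖ. -/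
structure ExtriangulatedCat extends ExtData.{v, u, w, z} 𝕜 C where
  /-- every morphism of extensions is realized by a morphism of sequences -/
  realize : ∀ {A B C₁ A' B' C₁' : C} {δ : toExtData.Ext C₁ A} {δ' : toExtData.Ext C₁' A'}
    {x : A ⟶ B} {y : B ⟶ C₁} {x' : A' ⟶ B'} {y' : B' ⟶ C₁'},
    toExtData.Realizes δ x y → toExtData.Realizes δ' x' y' →
    ∀ (a : A ⟶ A') (c : C₁ ⟶ C₁'), toExtData.push a δ = toExtData.pull c δ' →
      ∃ b : B ⟶ B', x ≫ b = a ≫ x' ∧ b ≫ y' = y ≫ c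
  realize_zero : ∀ (A C₁ : C),
    toExtData.Realizes (0 : toExtData.Ext C₁ A) (biprod.inl : A ⟶ A ⊞ C₁) biprod.snd
  realize_sum : ∀ {A B C₁ A' B' C₁' : C} {δ : toExtData.Ext C₁ A} {δ' : toExtData.Ext C₁' A'}
    {x : A ⟶ B} {y : B ⟶ C₁} {x' : A' ⟶ B'} {y' : B' ⟶ C₁'},
    toExtData.Realizes δ x y → toExtData.Realizes δ' x' y' →
    toExtData.Realizes (toExtData.directSum δ δ') (biprod.map x x') (biprod.map y y')
  et3 : ∀ {A B C₁ A' B' C₁' : C} {δ : toExtData.Ext C₁ A} {δ' : toExtData.Ext C₁' A'}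
    {x : A ⟶ B} {y : B ⟶ C₁} {x' : A' ⟶ B'} {y' : B' ⟶ C₁'},
    toExtData.Realizes δ x y → toExtData.Realizes δ' x' y' →
    ∀ (a : A ⟶ A') (b : B ⟶ B'), x ≫ b = a ≫ x' →
      ∃ c : C₁ ⟶ C₁', y ≫ c = b ≫ y' ∧ toExtData.push a δ = toExtData.pull c δ'
  et3op : ∀ {A B C₁ A' B' C₁' : C} {δ : toExtData.Ext C₁ A} {δ' : toExtData.Ext C₁' A'}
    {x : A ⟶ B} {y : B ⟶ C₁} {x' : A' ⟶ B'} {y' : B' ⟶ C₁'},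
    toExtData.Realizes δ x y → toExtData.Realizes δ' x' y' →
    ∀ (b : B ⟶ B') (c : C₁ ⟶ C₁'), y ≫ c = b ≫ y' →
      ∃ a : A ⟶ A', x ≫ b = a ≫ x' ∧ toExtData.push a δ = toExtData.pull c δ'
  et4 : ∀ {A B D C₁ F : C} {δ : toExtData.Ext D A} {δ' : toExtData.Ext F B}
    {f : A ⟶ B} {f' : B ⟶ D} {g : B ⟶ C₁} {g' : C₁ ⟶ F},
    toExtData.Realizes δ f f' → toExtData.Realizes δ' g g' →
    ∃ (E₁ : C) (h' : C₁ ⟶ E₁) (d : D ⟶ E₁) (e : E₁ ⟶ F) (δ'' : toExtData.Ext E₁ A),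
      toExtData.Realizes δ'' (f ≫ g) h' ∧ f' ≫ d = g ≫ h' ∧ h' ≫ e = g' ∧
      toExtData.Realizes (toExtData.push f' δ') d e ∧
      toExtData.pull d δ'' = δ ∧
      toExtData.push f δ'' = toExtData.pull e δ'
  et4op : ∀ {D A B F C₁ : C} {δ : toExtData.Ext B D} {δ' : toExtData.Ext C₁ F}
    {f' : D ⟶ A} {f : A ⟶ B} {g' : F ⟶ B} {g : B ⟶ C₁},
    toExtData.Realizes δ f' f → toExtData.Realizes δ' g' g →
    ∃ (E₁ : C) (h' : E₁ ⟶ A) (d : D ⟶ E₁) (e : E₁ ⟶ F) (δ'' : toExtData.Ext C₁ E₁),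
      toExtData.Realizes δ'' h' (f ≫ g) ∧ d ≫ h' = f' ∧ e ≫ g' = h' ≫ f ∧
      toExtData.Realizes (toExtData.pull g' δ) d e ∧
      toExtData.push e δ'' = δ' ∧
      toExtData.push d δ = toExtData.pull g δ''

/-- A negative first extension structure: an additive bifunctor `𝔼⁻¹ : Cᵒᵖ × C → Ab`, and for
each `δ ∈ 𝔼(C', A)` natural transformations `δ_♯⁻¹ : 𝔼⁻¹(-, C') → C(-, A)` and
`δ^♯_{-1} : 𝔼⁻¹(A, -) → C(C', -)` such that for every `𝔰`-conflation the two sequences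
`𝔼⁻¹(W,A) → 𝔼⁻¹(W,B) → 𝔼⁻¹(W,C') → C(W,A) → C(W,B)` and
`𝔼⁻¹(C',W) → 𝔼⁻¹(B,W) → 𝔼⁻¹(A,W) → C(C',W) → C(B,W)` are exact. -/
structure NegExt (X : ExtriangulatedCat.{v, u, w, z} 𝕜 C) where
  /-- the bifunctor `𝔼⁻¹` -/
  E : Cᵒᵖ ⥤ C ⥤ AddCommGrpCat.{w'}
  map_right_add : ∀ (Y : Cᵒᵖ) {A A' : C} (a b : A ⟶ A'),
    (E.obj Y).map (a + b) = (E.obj Y).map a + (E.obj Y).map b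
  map_left_add : ∀ (A : C) {Y Y' : C} (a b : Y ⟶ Y'),
    (E.map (a + b).op).app A = (E.map a.op).app A + (E.map b.op).app A
  /-- the map `δ_♯⁻¹` at `W` -/
  lower : ∀ {C' A : C} (_ : X.Ext C' A) (W : C), (E.obj (op W)).obj C' →+ (W ⟶ A)
  lower_nat : ∀ {C' A : C} (δ : X.Ext C' A) {W W' : C} (h : W' ⟶ W)
    (ε : (E.obj (op W)).obj C'),
    lower δ W' (((E.map h.op).app C').hom ε) = h ≫ lower δ W ε
  /-- the map `δ^♯_{-1}` at `W` -/
  upper : ∀ {C' A : C} (_ : X.Ext C' A) (W : C), (E.obj (op A)).obj W →+ (C' ⟶ W)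
  upper_nat : ∀ {C' A : C} (δ : X.Ext C' A) {W W' : C} (h : W ⟶ W')
    (ε : (E.obj (op A)).obj W),
    upper δ W' (((E.obj (op A)).map h).hom ε) = upper δ W ε ≫ h
  lower_exact : ∀ {A B C' : C} {δ : X.Ext C' A} {f : A ⟶ B} {g : B ⟶ C'},
    X.Realizes δ f g → ∀ W : C,
      Function.Exact ((E.obj (op W)).map f).hom ((E.obj (op W)).map g).hom ∧
      Function.Exact ((E.obj (op W)).map g).hom (lower δ W) ∧
      Function.Exact (lower δ W) (fun h : W ⟶ A => h ≫ f)
  upper_exact : ∀ {A B C' : C} {δ : X.Ext C' A} {f : A ⟶ B} {g : B ⟶ C'},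
    X.Realizes δ f g → ∀ W : C,
      Function.Exact ((E.map g.op).app W).hom ((E.map f.op).app W).hom ∧
      Function.Exact ((E.map f.op).app W).hom (upper δ W) ∧
      Function.Exact (upper δ W) (fun h : C' ⟶ W => g ≫ h)

end Extriangulated

section Categories

variable {C : Type u} [Category.{v} C] [Preadditive C] [HasFiniteBiproducts C] [HasBinaryBiproducts C]

variable (C) in
/-- Every object is a finite direct sum of objects with local endomorphism rings. -/
def IsKrullSchmidt : Prop :=
  ∀ X : C, ∃ (n : ℕ) (Y : Fin n → C),
    (∀ i, IsLocalRing (End (Y i))) ∧ Nonempty (X ≅ ⨁ Y)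

/-- `N` is a brick: its endomorphism ring is a division ring. -/
def IsBrick (N : C) : Prop :=
  Nontrivial (End N) ∧ ∀ f : End N, f ≠ 0 → IsUnit f

/-- `α : P ⟶ M` is right minimal: every `φ : P ⟶ P` with `α φ = α` is an isomorphism. -/
def IsRightMinimal {P M : C} (α : P ⟶ M) : Prop :=
  ∀ φ : P ⟶ P, φ ≫ α = α → IsIso φ

/-- `add M`: direct summands of finite direct sums of copies of `M`. -/
def addClosure (M : C) : ObjectProperty C := fun Y =>
  ∃ (n : ℕ) (Z : C), Nonempty (Y ⊞ Z ≅ ⨁ fun _ : Fin n => M)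

/-- The right perpendicular category `P^{⊥_C} = {M | C(P, M) = 0}`. -/
def rightHomPerp (P : ObjectProperty C) : ObjectProperty C := fun M =>
  ∀ Y, P Y → ∀ f : Y ⟶ M, f = 0

/-- The object `Θ(j) ⊕ ⋯ ⊕ Θ(t)`. -/
noncomputable def sumGE {t : ℕ} (Θ : Fin t → C) (j : Fin t) : C :=
  ⨁ fun i : {i : Fin t // j ≤ i} => Θ i.1

/-- (MS2) `C(Θ(i), Θ(j)) = 0` for `i > j`. -/
def MS2 {t : ℕ} (Θ : Fin t → C) : Prop := ∀ i j, j < i → ∀ f : Θ i ⟶ Θ j, f = 0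

end Categories

section Notions

variable {𝕜 : Type z} [Field 𝕜] {C : Type u} [Category.{v} C] [Preadditive C]
  [Linear 𝕜 C] [HasFiniteBiproducts C] [HasBinaryBiproducts C]

namespace ExtData

variable (X : ExtData.{v, u, w, z} 𝕜 C)

/-- `𝔼(M, N)` is a left `End N`-module (that is, a right `(End N)ᵒᵖ`-module) through
`φ • δ = φ_* δ`; multiplication in `End N` is composition in the order `(φ ψ)(x) = φ(ψ(x))`. -/
@[reducible] def endModule (M N : C) : Module (End N) (X.Ext M N) where
  smul φ δ := X.push (φ : N ⟶ N) δ
  one_smul δ := by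
    change ((X.E.obj (op M)).map (𝟙 N)).hom δ = δ
    simp
  mul_smul φ ψ δ := by
    change ((X.E.obj (op M)).map ((ψ : N ⟶ N) ≫ (φ : N ⟶ N))).hom δ = _
    rw [Functor.map_comp]
    rfl
  smul_zero φ := (X.push (φ : N ⟶ N)).map_zero
  smul_add φ := (X.push (φ : N ⟶ N)).map_add
  add_smul φ ψ δ := by
    change ((X.E.obj (op M)).map ((φ : N ⟶ N) + (ψ : N ⟶ N))).hom δ = _
    rw [X.map_right_add]
    rfl
  zero_smul δ := by
    change ((X.E.obj (op M)).map (0 : N ⟶ N)).hom δ = 0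
    have h := X.map_right_smul (op M) (0 : 𝕜) (0 : N ⟶ N)
    rw [zero_smul, zero_smul] at h
    rw [h]
    rfl

/-- `δ₁, …, δ_d` is a `D_N`-basis of `𝔼(M, N)`, where `D_N` is `(End N)ᵒᵖ` (acting from the
right) if `N` is a brick and `D_N = 𝕜` otherwise. -/
def IsDBasis {M N : C} {d : ℕ} (δ : Fin d → X.Ext M N) : Prop :=
  (IsBrick N → letI := X.endModule M N
    LinearIndependent (End N) δ ∧ Submodule.span (End N) (Set.range δ) = ⊤) ∧
  (¬ IsBrick N →
    LinearIndependent 𝕜 δ ∧ Submodule.span 𝕜 (Set.range δ) = ⊤)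

/-- `g : P ⟶ M` is the deflation of a `D_N`-universal extension `N^{⊕d} ⟶ P ⟶ M ⇢` of `M` by
`N`: the components of the extension class form a `D_N`-basis of `𝔼(M, N)`. -/
def IsUniversalExtension (N : C) {P M : C} (g : P ⟶ M) : Prop :=
  ∃ (d : ℕ) (δ : X.Ext M (⨁ fun _ : Fin d => N)) (f : (⨁ fun _ : Fin d => N) ⟶ P),
    X.Realizes δ f g ∧
    X.IsDBasis fun i => X.push (biproduct.π (fun _ : Fin d => N) i) δ

/-- `ℰ` admits a finite sequence of universal extensions by `N`: for every `M ∈ ℰ`, in the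
sequence `⋯ ⟶ P 2 ⟶ P 1 ⟶ P 0 = M` of iterated `D_N`-universal extensions by `N`, some map is
an isomorphism. (The sequence is unique up to isomorphism.) -/
def AdmitsFiniteUniversalExtensions (ℰ : ObjectProperty C) (N : C) : Prop :=
  ∀ M, ℰ M → ∃ (P : ℕ → C) (a : ∀ s, P (s + 1) ⟶ P s),
    P 0 = M ∧ (∀ s, X.IsUniversalExtension N (a s)) ∧ ∃ s, IsIso (a s)

/-- `N` is a stone: it is indecomposable and `𝔼(N, N) = 0`. -/
def IsStone (N : C) : Prop :=
  Indecomposable N ∧ Subsingleton (X.Ext N N)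

/-- `P * Q`: the objects `M` with an `𝔰`-conflation `Y ⟶ M ⟶ Z ⇢`, `Y ∈ P`, `Z ∈ Q`. -/
def star (P Q : ObjectProperty C) : ObjectProperty C := fun M =>
  ∃ (Y Z : C) (f : Y ⟶ M) (g : M ⟶ Z), P Y ∧ Q Z ∧ X.IsConflation f g

/-- `ℰ * ℰ ⊆ ℰ`. -/
def IsExtensionClosed (ℰ : ObjectProperty C) : Prop := X.star ℰ ℰ ≤ ℰ

/-- `add M * ⋯ * add M` with `l + 1` factors. -/
def filtPow (M : C) : ℕ → ObjectProperty C
  | 0 => addClosure M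
  | l + 1 => X.star (addClosure M) (filtPow M l)

/-- `𝓕(M)`, the union of all `add M * ⋯ * add M`. -/
def Filt (M : C) : ObjectProperty C := fun Y => ∃ l, X.filtPow M l Y

/-- The left perpendicular category `^{⊥_𝔼}P = {M | 𝔼(M, P) = 0}`. -/
def leftExtPerp (P : ObjectProperty C) : ObjectProperty C := fun M =>
  ∀ Y, P Y → Subsingleton (X.Ext M Y)

/-- `𝔼(M, N)` is finite-dimensional over `𝕜` for all `M, N ∈ ℰ`. -/
def IsExtFinite (ℰ : ObjectProperty C) : Prop :=
  ∀ M N, ℰ M → ℰ N → Module.Finite 𝕜 (X.Ext M N)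

/-- (MS1) Every `Θ(i)` is a brick or a stone. -/
def MS1 {t : ℕ} (Θ : Fin t → C) : Prop := ∀ i, IsBrick (Θ i) ∨ X.IsStone (Θ i)

/-- (MS3) `𝔼(Θ(i), Θ(j)) = 0` for `i > j`. -/
def MS3 {t : ℕ} (Θ : Fin t → C) : Prop := ∀ i j, j < i → Subsingleton (X.Ext (Θ i) (Θ j))

/-- `j` is the minimum value with `𝔼(M, Θ(j)) ≠ 0`. -/
def IsMinIndex {t : ℕ} (Θ : Fin t → C) (M : C) (j : Fin t) : Prop :=
  IsLeast {i : Fin t | Nontrivial (X.Ext M (Θ i))} j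

end ExtData

/-- (MS4) `𝔼⁻¹(Θ, Θ) = 0`. -/
def NegExt.MS4 {X : ExtriangulatedCat.{v, u, w, z} 𝕜 C} (N : NegExt.{v, u, w, w', z} X)
    {t : ℕ} (Θ : Fin t → C) : Prop :=
  ∀ i j, Subsingleton ((N.E.obj (op (Θ i))).obj (Θ j))

end Notions

end MixedStd

set_option linter.unusedSectionVars false

namespace MixedStd

open ZeroObject

/-- The maps `q : A ⟶ B` and `ρ : B ⟶ D`, together with `p : B ⟶ A` and `e : D ⟶ B`, exhibit `B`
as the direct sum of `A` and `D`. -/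
structure IsDirectSum {C : Type u} [Category.{v} C] [Preadditive C] {A B D : C}
    (q : A ⟶ B) (ρ : B ⟶ D) (p : B ⟶ A) (e : D ⟶ B) : Prop where
  q_p : q ≫ p = 𝟙 A
  e_ρ : e ≫ ρ = 𝟙 D
  q_ρ : q ≫ ρ = 0
  e_p : e ≫ p = 0
  total : p ≫ q + ρ ≫ e = 𝟙 B

section ExactSequences

variable {𝕜 : Type z} [Field 𝕜] {C : Type u} [Category.{v} C] [Preadditive C]
  [Linear 𝕜 C] [HasFiniteBiproducts C] [HasBinaryBiproducts C]

namespace ExtData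

variable (X : ExtData.{v, u, w, z} 𝕜 C)

lemma push_comp {W A B D : C} (a : A ⟶ B) (b : B ⟶ D) (δ : X.Ext W A) :
    X.push (a ≫ b) δ = X.push b (X.push a δ) := by
  simp [push]

lemma push_id {W A : C} (δ : X.Ext W A) : X.push (𝟙 A) δ = δ := by
  simp [push]

lemma push_add {W A B : C} (a b : A ⟶ B) (δ : X.Ext W A) :
    X.push (a + b) δ = X.push a δ + X.push b δ := by
  simp [push, X.map_right_add]

lemma push_smul {W A B : C} (r : 𝕜) (a : A ⟶ B) (δ : X.Ext W A) :
    X.push (r • a) δ = r • X.push a δ := by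
  simp [push, X.map_right_smul]

lemma push_zero {W A B : C} (δ : X.Ext W A) : X.push (0 : A ⟶ B) δ = 0 := by
  simpa using X.push_smul (0 : 𝕜) (0 : A ⟶ B) δ

lemma pull_comp {U V W A : C} (a : U ⟶ V) (b : V ⟶ W) (δ : X.Ext W A) :
    X.pull (a ≫ b) δ = X.pull a (X.pull b δ) := by
  simp [pull]

lemma pull_id {W A : C} (δ : X.Ext W A) : X.pull (𝟙 W) δ = δ := by
  simp [pull]

lemma pull_add {V W A : C} (a b : V ⟶ W) (δ : X.Ext W A) :
    X.pull (a + b) δ = X.pull a δ + X.pull b δ := by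
  exact congrArg (fun k => k.hom δ) (X.map_left_add A a b)

lemma pull_zero {V W A : C} (δ : X.Ext W A) : X.pull (0 : V ⟶ W) δ = 0 := by
  have h := X.pull_add (0 : V ⟶ W) 0 δ
  simpa using h

lemma push_pull {V W A B : C} (a : A ⟶ B) (c : V ⟶ W) (δ : X.Ext W A) :
    X.push a (X.pull c δ) = X.pull c (X.push a δ) := by
  simp [push, pull]

lemma push_sum {W A B : C} {ι : Type*} (s : Finset ι) (a : ι → (A ⟶ B)) (δ : X.Ext W A) :
    X.push (∑ i ∈ s, a i) δ = ∑ i ∈ s, X.push (a i) δ := by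
  classical
  induction s using Finset.induction_on with
  | empty => simp [push_zero]
  | insert i s hi ih => rw [Finset.sum_insert hi, Finset.sum_insert hi, push_add, ih]

lemma subsingleton_of_isZero_right {W A : C} (hA : IsZero A) : Subsingleton (X.Ext W A) := by
  refine ⟨fun a b => ?_⟩
  rw [← X.push_id a, ← X.push_id b, hA.eq_of_src (𝟙 A) 0, push_zero, push_zero]

lemma subsingleton_of_isZero_left {W A : C} (hW : IsZero W) : Subsingleton (X.Ext W A) := by
  refine ⟨fun a b => ?_⟩
  rw [← X.pull_id a, ← X.pull_id b, hW.eq_of_src (𝟙 W) 0, pull_zero, pull_zero]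

lemma subsingleton_of_retract {W A B : C} (r : Retract A B) [Subsingleton (X.Ext W B)] :
    Subsingleton (X.Ext W A) := by
  refine ⟨fun a b => ?_⟩
  rw [← X.push_id a, ← X.push_id b, ← r.retract, push_comp, push_comp,
    Subsingleton.elim (X.push r.i a) (X.push r.i b)]

lemma subsingleton_of_retract_left {V W A : C} (r : Retract V W) [Subsingleton (X.Ext W A)] :
    Subsingleton (X.Ext V A) := by
  refine ⟨fun a b => ?_⟩
  rw [← X.pull_id a, ← X.pull_id b, ← r.retract, pull_comp, pull_comp,
    Subsingleton.elim (X.pull r.r a) (X.pull r.r b)]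

lemma exists_realizes {W A : C} (δ : X.Ext W A) :
    ∃ (B : C) (f : A ⟶ B) (g : B ⟶ W), X.Realizes δ f g := by
  obtain ⟨S, hS⟩ := Quotient.exists_rep (X.s δ)
  exact ⟨S.B, S.f, S.g, hS.symm⟩

variable {X}

lemma Realizes.of_iso {A B B' W : C} {δ : X.Ext W A} {f : A ⟶ B} {g : B ⟶ W}
    (h : X.Realizes δ f g) (b : B ≅ B') {f' : A ⟶ B'} {g' : B' ⟶ W}
    (hf : f ≫ b.hom = f') (hg : b.hom ≫ g' = g) : X.Realizes δ f' g' :=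
  Eq.trans h (Quotient.sound ⟨b, hf, hg⟩)

end ExtData

namespace ExtriangulatedCat

open ExtData

variable {X : ExtriangulatedCat.{v, u, w, z} 𝕜 C}

/-- A direct sum decomposition is a conflation with zero extension class. -/
lemma realizes_zero_of_isDirectSum {A B D : C} {q : A ⟶ B} {ρ : B ⟶ D} {p : B ⟶ A} {e : D ⟶ B}
    (h : IsDirectSum q ρ p e) : X.Realizes (0 : X.Ext D A) q ρ := by
  refine (X.realize_zero A D).of_iso
    ⟨biprod.desc q e, biprod.lift p ρ, ?_, ?_⟩ (by simp) ?_
  · ext <;> simp [h.q_p, h.q_ρ, h.e_p, h.e_ρ]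
  · simp [h.total]
  · ext <;> simp [h.q_ρ, h.e_ρ]

lemma realizes_id_left {A Z : C} (hZ : IsZero Z) :
    X.Realizes (0 : X.Ext Z A) (𝟙 A) (0 : A ⟶ Z) :=
  realizes_zero_of_isDirectSum (p := 𝟙 A) (e := 0)
    ⟨by simp, hZ.eq_of_src _ _, by simp, by simp, by simp⟩

lemma realizes_id_right {A Z : C} (hZ : IsZero Z) :
    X.Realizes (0 : X.Ext A Z) (0 : Z ⟶ A) (𝟙 A) :=
  realizes_zero_of_isDirectSum (p := 0) (e := 𝟙 A)
    ⟨hZ.eq_of_src _ _, by simp, by simp, by simp, by simp⟩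

section

variable {A B D : C} {δ : X.Ext D A} {f : A ⟶ B} {g : B ⟶ D} (h : X.Realizes δ f g)

include h

lemma comp_eq_zero : f ≫ g = 0 := by
  obtain ⟨c, hc, -⟩ := X.et3 (realizes_id_left (X := X) (A := A) (isZero_zero C)) h (𝟙 A) f (by simp)
  simpa using hc.symm

/-- Exactness of `C(W, A) → C(W, B) → C(W, D)`. -/
lemma exists_lift {W : C} (k : W ⟶ B) (hk : k ≫ g = 0) : ∃ a : W ⟶ A, a ≫ f = k := by
  obtain ⟨a, ha, -⟩ := X.et3op (realizes_id_left (X := X) (A := W) (isZero_zero C)) h k 0 (by simp [hk])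
  exact ⟨a, by simpa using ha.symm⟩

/-- Exactness of `C(D, W) → C(B, W) → C(A, W)`. -/
lemma exists_desc {W : C} (k : B ⟶ W) (hk : f ≫ k = 0) : ∃ c : D ⟶ W, g ≫ c = k := by
  obtain ⟨a, ha, -⟩ := X.et3 h (realizes_id_right (X := X) (A := W) (isZero_zero C)) 0 k (by simp [hk])
  exact ⟨a, by simpa using ha⟩

lemma push_inflation : X.push f δ = 0 := by
  obtain ⟨c, -, hc⟩ := X.et3 h (realizes_id_left (X := X) (A := B) (isZero_zero C)) f (𝟙 B) (by simp)
  simpa using hc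

lemma pull_deflation : X.pull g δ = 0 := by
  obtain ⟨c, -, hc⟩ := X.et3op (realizes_id_right (X := X) (A := B) (isZero_zero C)) h (𝟙 B) g (by simp)
  simpa using hc.symm

/-- Exactness of `C(B, W) → C(A, W) → 𝔼(D, W)`. -/
lemma exists_extend {W : C} (a : A ⟶ W) (ha : X.push a δ = 0) : ∃ b : B ⟶ W, f ≫ b = a := by
  obtain ⟨b, hb, -⟩ := X.realize h (realizes_id_left (X := X) (A := W) (isZero_zero C)) a 0
    (by simp [ha])
  exact ⟨b, by simpa using hb⟩

/-- Exactness of `C(W, B) → C(W, D) → 𝔼(W, A)`. -/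
lemma exists_lift_of_pull {W : C} (c : W ⟶ D) (hc : X.pull c δ = 0) :
    ∃ b : W ⟶ B, b ≫ g = c := by
  obtain ⟨b, -, hb⟩ := X.realize (realizes_id_right (X := X) (A := W) (isZero_zero C)) h 0 c
    (by simp [hc])
  exact ⟨b, by simpa using hb⟩

/-- Exactness of `𝔼(W, A) → 𝔼(W, B) → 𝔼(W, D)`. -/
lemma exists_push_eq {W : C} (θ : X.Ext W B) (hθ : X.push g θ = 0) :
    ∃ η : X.Ext W A, X.push f η = θ := by
  obtain ⟨E, f', g', h'⟩ := X.exists_realizes θ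
  obtain ⟨E₁, _, d, e, δ'', -, -, -, h₁, -, h₂⟩ := X.et4 h h'
  obtain ⟨s, hs⟩ := exists_lift_of_pull h₁ (𝟙 W) (by rw [hθ, map_zero])
  exact ⟨X.pull s δ'', by rw [push_pull, h₂, ← pull_comp, hs, pull_id]⟩

/-- Exactness of `𝔼(D, W) → 𝔼(B, W) → 𝔼(A, W)`. -/
lemma exists_pull_eq {W : C} (θ : X.Ext B W) (hθ : X.pull f θ = 0) :
    ∃ η : X.Ext D W, X.pull g η = θ := by
  obtain ⟨E, f', g', h'⟩ := X.exists_realizes θ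
  obtain ⟨E₁, _, d, e, δ'', -, -, -, h₁, -, h₂⟩ := X.et4op h' h
  obtain ⟨s, hs⟩ := exists_extend h₁ (𝟙 W) (by rw [hθ, map_zero])
  exact ⟨X.push s δ'', by rw [← push_pull, ← h₂, ← push_comp, hs, push_id]⟩

lemma ext_subsingleton_of_right {W : C} (hA : Subsingleton (X.Ext W A))
    (hD : Subsingleton (X.Ext W D)) : Subsingleton (X.Ext W B) := by
  refine subsingleton_of_forall_eq 0 fun θ => ?_
  obtain ⟨η, rfl⟩ := exists_push_eq h θ (Subsingleton.elim _ _)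
  rw [Subsingleton.elim η 0, map_zero]

lemma ext_subsingleton_of_left {W : C} (hA : Subsingleton (X.Ext A W))
    (hD : Subsingleton (X.Ext D W)) : Subsingleton (X.Ext B W) := by
  refine subsingleton_of_forall_eq 0 fun θ => ?_
  obtain ⟨η, rfl⟩ := exists_pull_eq h θ (Subsingleton.elim _ _)
  rw [Subsingleton.elim η 0, map_zero]

/-- A morphism of conflations that is invertible at both ends is invertible. -/
lemma isIso_middle {A' B' D' : C} {δ' : X.Ext D' A'} {f' : A' ⟶ B'} {g' : B' ⟶ D'}
    (h' : X.Realizes δ' f' g') (a : A ⟶ A') (b : B ⟶ B') (c : D ⟶ D') [IsIso a] [IsIso c]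
    (hf : f ≫ b = a ≫ f') (hg : b ≫ g' = g ≫ c) (hδ : X.push a δ = X.pull c δ') : IsIso b := by
  obtain ⟨s, hs⟩ : ∃ s : B' ⟶ B, s ≫ b = 𝟙 B' := by
    obtain ⟨k, hk⟩ := exists_lift_of_pull h (g' ≫ inv c) (by
      have : X.push a (X.pull (g' ≫ inv c) δ) = 0 := by
        rw [push_pull, hδ, ← pull_comp]
        simp [pull_deflation h']
      rw [← X.push_id (X.pull _ _), ← IsIso.hom_inv_id a, push_comp, this, map_zero])
    obtain ⟨l, hl⟩ := exists_lift h' (𝟙 B' - k ≫ b) (by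
      simp [hg, reassoc_of% hk])
    refine ⟨k + l ≫ inv a ≫ f, ?_⟩
    simp [hf, hl]
  obtain ⟨r, hr⟩ : ∃ r : B' ⟶ B, b ≫ r = 𝟙 B := by
    obtain ⟨k, hk⟩ := exists_extend h' (inv a ≫ f) (by
      have : X.pull c (X.push (inv a ≫ f) δ') = 0 := by
        rw [← push_pull, ← hδ, ← push_comp]
        simp [push_inflation h]
      rw [← X.pull_id (X.push _ _), ← IsIso.inv_hom_id c, pull_comp, this, map_zero])
    obtain ⟨l, hl⟩ := exists_desc h (𝟙 B - b ≫ k) (by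
      rw [Preadditive.comp_sub, ← Category.assoc, hf, Category.assoc, hk]; simp)
    refine ⟨k + g' ≫ inv c ≫ l, ?_⟩
    rw [Preadditive.comp_add, reassoc_of% hg]; simp [hl]
  have hrs : s = r := by rw [← Category.comp_id s, ← hr, reassoc_of% hs]
  exact ⟨r, hr, hrs ▸ hs⟩

lemma isIso_deflation (hA : IsZero A) : IsIso g := by
  have := X.subsingleton_of_isZero_right (W := D) hA
  obtain ⟨s, hs⟩ := exists_lift_of_pull h (𝟙 D) (Subsingleton.elim _ _)
  obtain ⟨a, ha⟩ := exists_lift h (g ≫ s - 𝟙 B) (by simp [hs])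
  refine ⟨s, ?_, hs⟩
  rw [← sub_eq_zero, ← ha, hA.eq_of_tgt a 0, zero_comp]

lemma isIso_inflation (hD : IsZero D) : IsIso f := by
  have := X.subsingleton_of_isZero_left (A := A) hD
  obtain ⟨s, hs⟩ := exists_extend h (𝟙 A) (Subsingleton.elim _ _)
  obtain ⟨a, ha⟩ := exists_desc h (s ≫ f - 𝟙 B) (by simp [reassoc_of% hs])
  refine ⟨s, hs, ?_⟩
  rw [← sub_eq_zero, ← ha, hD.eq_of_src a 0, comp_zero]

/-- A conflation with zero extension class splits. -/
lemma exists_isDirectSum (hδ : δ = 0) : ∃ (p : B ⟶ A) (e : D ⟶ B), IsDirectSum f g p e := by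
  subst hδ
  obtain ⟨p, hp⟩ := exists_extend h (𝟙 A) (map_zero _)
  obtain ⟨e, he⟩ := exists_desc h (𝟙 B - p ≫ f) (by simp [reassoc_of% hp])
  have hfg := comp_eq_zero h
  obtain ⟨s, hs⟩ := exists_lift_of_pull h (𝟙 D) (map_zero _)
  have h1 : e = s - s ≫ p ≫ f := by
    rw [← Category.id_comp e, ← hs, Category.assoc, he]; simp
  refine ⟨p, e, hp, ?_, hfg, ?_, ?_⟩
  · simp [h1, hs, hfg]
  · simp [h1, hp]
  · simp [he]

end

end ExtriangulatedCat

end ExactSequences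

end MixedStd

namespace MixedStd

open ZeroObject

section KrullSchmidt

variable {C : Type u} [Category.{v} C] [Preadditive C]

namespace IsDirectSum

variable {A B D : C} {q : A ⟶ B} {ρ : B ⟶ D} {p : B ⟶ A} {e : D ⟶ B}

lemma of_iso (h : IsDirectSum q ρ p e) {B' : C} (b : B ≅ B') :
    IsDirectSum (q ≫ b.hom) (b.inv ≫ ρ) (b.inv ≫ p) (e ≫ b.hom) where
  q_p := by simp [h.q_p]
  e_ρ := by simp [h.e_ρ]
  q_ρ := by simp [h.q_ρ]
  e_p := by simp [h.e_p]
  total := by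
    have : b.inv ≫ (p ≫ q + ρ ≫ e) ≫ b.hom = 𝟙 B' := by simp [h.total]
    simpa using this

lemma symm (h : IsDirectSum q ρ p e) : IsDirectSum e p ρ q where
  q_p := h.e_ρ
  e_ρ := h.q_p
  q_ρ := h.e_p
  e_p := h.q_ρ
  total := by rw [add_comm, h.total]

/-- A retract `Z` of `A ⊕ D` that maps isomorphically to `D` has a complement isomorphic
to `A`. -/
lemma complement (h : IsDirectSum q ρ p e) {Z : C} {i : Z ⟶ B} {r : B ⟶ Z} (hir : i ≫ r = 𝟙 Z)
    [IsIso (i ≫ ρ)] :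
    IsDirectSum (q ≫ (𝟙 B - r ≫ i)) r ((𝟙 B - ρ ≫ inv (i ≫ ρ) ≫ i) ≫ p) i := by
  have h1 : i ≫ ρ ≫ inv (i ≫ ρ) = 𝟙 Z := by
    rw [← Category.assoc, IsIso.hom_inv_id]
  have h2 : ρ ≫ inv (i ≫ ρ) ≫ i ≫ ρ = ρ := by simp
  have h3 : p ≫ q = 𝟙 B - ρ ≫ e := by rw [← h.total]; simp
  refine ⟨?_, hir, ?_, ?_, ?_⟩
  · simp only [Preadditive.sub_comp, Preadditive.comp_sub, Category.assoc, Category.comp_id,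
      Category.id_comp, reassoc_of% h1, h.q_p, reassoc_of% h.q_ρ, zero_comp]
    simp
  · simp [hir]
  · simp [reassoc_of% h1]
  · generalize inv (i ≫ ρ) = v at h1 h2 ⊢
    have : ((𝟙 B - ρ ≫ v ≫ i) ≫ p) ≫ q ≫ (𝟙 B - r ≫ i) = 𝟙 B - r ≫ i := by
      rw [Category.assoc, reassoc_of% h3]
      simp only [Preadditive.sub_comp, Preadditive.comp_sub, Category.assoc, Category.comp_id,
        Category.id_comp, reassoc_of% hir, reassoc_of% h2]
      abel
    rw [this]; simp

/-- Complements can be taken in two steps. -/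
lemma trans {Z Z₁ Z₂ W W₁ W₂ : C} {a : Z₁ ⟶ Z} {b : Z ⟶ Z₂} {c : Z ⟶ Z₁} {d : Z₂ ⟶ Z}
    (hZ : IsDirectSum a b c d) {i : Z ⟶ W} {r : W ⟶ Z} (hir : i ≫ r = 𝟙 Z)
    {q₁ : W₁ ⟶ W} {p₁ : W ⟶ W₁} (h₁ : IsDirectSum q₁ (r ≫ b) p₁ (d ≫ i))
    {q₂ : W₂ ⟶ W₁} {p₂ : W₁ ⟶ W₂}
    (h₂ : IsDirectSum q₂ (q₁ ≫ r ≫ c) p₂ (a ≫ i ≫ p₁)) :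
    IsDirectSum (q₂ ≫ q₁) r (p₁ ≫ p₂) i := by
  have e1 := h₁.q_ρ
  have e2 := h₁.e_p
  have e3 : p₁ ≫ q₁ = 𝟙 W - r ≫ b ≫ d ≫ i := by rw [← h₁.total]; simp
  have e4 : p₂ ≫ q₂ = 𝟙 W₁ - q₁ ≫ r ≫ c ≫ a ≫ i ≫ p₁ := by rw [← h₂.total]; simp
  have e5 : c ≫ a = 𝟙 Z - b ≫ d := by rw [← hZ.total]; simp
  have e6 := hZ.q_ρ
  have e7 := hZ.e_p
  have e8 := h₂.q_ρ
  have e9 := h₂.e_p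
  simp only [Category.assoc] at e1 e2 e8 e9
  refine ⟨?_, hir, ?_, ?_, ?_⟩
  · simp [reassoc_of% h₁.q_p, h₂.q_p]
  · have : q₂ ≫ q₁ ≫ r ≫ (c ≫ a + b ≫ d) = 0 := by
      rw [Preadditive.comp_add, Preadditive.comp_add, Preadditive.comp_add, reassoc_of% e8,
        reassoc_of% e1]
      simp
    simpa [hZ.total] using this
  · have : (c ≫ a + b ≫ d) ≫ i ≫ p₁ ≫ p₂ = 0 := by
      rw [Preadditive.add_comp, Category.assoc, Category.assoc, e9, reassoc_of% e2]
      simp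
    simpa [hZ.total] using this
  · have k1 : p₁ ≫ q₁ ≫ r ≫ c = r ≫ c := by
      rw [reassoc_of% e3, Preadditive.sub_comp]
      simp [reassoc_of% hir, e7]
    have k2 : a ≫ i ≫ p₁ ≫ q₁ = a ≫ i := by
      rw [e3, Preadditive.comp_sub, Preadditive.comp_sub, reassoc_of% hir, reassoc_of% e6]
      simp
    rw [Category.assoc, reassoc_of% e4]
    simp only [Preadditive.sub_comp, Preadditive.comp_sub, Category.assoc, Category.id_comp]
    rw [reassoc_of% k1, k2, e3, reassoc_of% e5]
    simp

/-- Complements of the same map are isomorphic. -/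
lemma exists_iso (h : IsDirectSum q ρ p e) {A' : C} {q' : A' ⟶ B} {ρ' : B ⟶ D} {p' : B ⟶ A'}
    (h' : IsDirectSum q' ρ' p' e) : ∃ a : A ≅ A', a.hom = q ≫ p' ∧ a.inv = q' ≫ p := by
  refine ⟨⟨q ≫ p', q' ≫ p, ?_, ?_⟩, rfl, rfl⟩
  · have e1 : p' ≫ q' = 𝟙 B - ρ' ≫ e := by rw [← h'.total]; simp
    simp [reassoc_of% e1, h.e_p, h.q_p]
  · have e1 : p ≫ q = 𝟙 B - ρ ≫ e := by rw [← h.total]; simp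
    simp [reassoc_of% e1, h'.e_p, h'.q_p]

lemma isIso_left (h : IsDirectSum q ρ p e) (hD : IsZero D) : IsIso q :=
  ⟨p, h.q_p, by rw [← h.total, hD.eq_of_src e 0]; simp⟩

end IsDirectSum

/-- An object with local endomorphism ring. -/
def IsLocalObject (Y : C) : Prop :=
  ¬ IsZero Y ∧ ∀ f g : Y ⟶ Y, f + g = 𝟙 Y → IsIso f ∨ IsIso g

lemma isLocalObject_of_isLocalRing {Y : C} (h : IsLocalRing (End Y)) : IsLocalObject Y := by
  refine ⟨fun hY => ?_, fun f g hfg => ?_⟩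
  · exact one_ne_zero (α := End Y) (hY.eq_of_src _ _)
  · have := IsLocalRing.isUnit_or_isUnit_of_add_one (R := End Y) (a := f) (b := g) hfg
    simpa only [isUnit_iff_isIso] using this

lemma IsLocalObject.of_iso {Y Z : C} (h : IsLocalObject Y) (i : Y ≅ Z) : IsLocalObject Z := by
  refine ⟨fun hZ => h.1 (hZ.of_iso i), fun f g hfg => ?_⟩
  have := h.2 (i.hom ≫ f ≫ i.inv) (i.hom ≫ g ≫ i.inv) (by
    rw [← Preadditive.comp_add, ← Preadditive.add_comp, hfg]; simp)
  have key : ∀ k : Z ⟶ Z, IsIso (i.hom ≫ k ≫ i.inv) → IsIso k := fun k hk => by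
    have : k = i.inv ≫ (i.hom ≫ k ≫ i.inv) ≫ i.hom := by simp
    rw [this]; infer_instance
  exact this.imp (key f) (key g)

lemma IsBrick.isLocalObject {N : C} (h : IsBrick N) : IsLocalObject N := by
  obtain ⟨h1, h2⟩ := h
  refine ⟨fun hN => ?_, fun f g hfg => ?_⟩
  · exact one_ne_zero (α := End N) (hN.eq_of_src _ _)
  · by_cases hf : f = 0
    · right
      rw [hf, zero_add] at hfg
      rw [hfg]; infer_instance
    · left
      exact (isUnit_iff_isIso f).1 (h2 f hf)

lemma IsLocalObject.exists_isIso {Y : C} (h : IsLocalObject Y) {ι : Type*} (s : Finset ι)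
    (f : ι → (Y ⟶ Y)) (hs : IsIso (∑ i ∈ s, f i)) : ∃ i, IsIso (f i) := by
  classical
  induction s using Finset.induction_on with
  | empty =>
    rw [Finset.sum_empty] at hs
    refine (h.1 ?_).elim
    rw [IsZero.iff_id_eq_zero, ← IsIso.hom_inv_id (0 : Y ⟶ Y), zero_comp]
  | insert i s hi ih =>
    rw [Finset.sum_insert hi] at hs
    rcases h.2 (f i ≫ inv (f i + ∑ j ∈ s, f j)) ((∑ j ∈ s, f j) ≫ inv (f i + ∑ j ∈ s, f j))
      (by rw [← Preadditive.add_comp, IsIso.hom_inv_id]) with h1 | h1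
    · exact ⟨i, IsIso.of_isIso_comp_right _ (inv (f i + ∑ j ∈ s, f j))⟩
    · exact ih (IsIso.of_isIso_comp_right _ (inv (f i + ∑ j ∈ s, f j)))

lemma IsLocalObject.isIso_of_comp {Z Y : C} (hZ : IsLocalObject Z) (hY : IsLocalObject Y)
    (x : Z ⟶ Y) (y : Y ⟶ Z) [IsIso (x ≫ y)] : IsIso x := by
  have hx : x ≫ y ≫ inv (x ≫ y) = 𝟙 Z := by rw [← Category.assoc, IsIso.hom_inv_id]
  rcases hY.2 (y ≫ inv (x ≫ y) ≫ x) (𝟙 Y - y ≫ inv (x ≫ y) ≫ x) (by simp) with h | h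
  · refine ⟨y ≫ inv (x ≫ y), hx, ?_⟩
    rw [← cancel_mono (y ≫ inv (x ≫ y) ≫ x)]
    simp only [Category.assoc, Category.id_comp, reassoc_of% hx]
  · have h0 : x = 0 := by
      rw [← cancel_mono (𝟙 Y - y ≫ inv (x ≫ y) ≫ x), Preadditive.comp_sub, reassoc_of% hx]
      simp
    refine (hZ.1 ?_).elim
    rw [IsZero.iff_id_eq_zero, ← hx]
    generalize y ≫ inv (x ≫ y) = k
    rw [h0, zero_comp]

/-- The categorical Jacobson radical. -/
def InRadical {A B : C} (f : A ⟶ B) : Prop :=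
  ∀ g : B ⟶ A, IsIso (𝟙 A - f ≫ g)

namespace InRadical

lemma comp_right {A B D : C} {f : A ⟶ B} (hf : InRadical f) (h : B ⟶ D) :
    InRadical (f ≫ h) := fun g => by
  simpa using hf (h ≫ g)

lemma comp_left {A B D : C} {f : A ⟶ B} (hf : InRadical f) (h : D ⟶ A) :
    InRadical (h ≫ f) := fun g => by
  have := hf (g ≫ h)
  set t := inv (𝟙 A - f ≫ g ≫ h)
  have h1 : t - f ≫ g ≫ h ≫ t = 𝟙 A := by
    have : (𝟙 A - f ≫ g ≫ h) ≫ t = 𝟙 A := IsIso.hom_inv_id _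
    simpa using this
  have h2 : t - t ≫ f ≫ g ≫ h = 𝟙 A := by
    have : t ≫ (𝟙 A - f ≫ g ≫ h) = 𝟙 A := IsIso.inv_hom_id _
    simpa using this
  refine ⟨𝟙 D + h ≫ t ≫ f ≫ g, ?_, ?_⟩
  · have := congrArg (fun k => h ≫ k ≫ f ≫ g) h1
    simp only [Preadditive.sub_comp, Preadditive.comp_sub, Category.assoc, Category.id_comp] at this
    simp only [Preadditive.sub_comp, Preadditive.comp_add, Category.assoc, Category.id_comp,
      Category.comp_id]
    rw [← this]; abel
  · have := congrArg (fun k => h ≫ k ≫ f ≫ g) h2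
    simp only [Preadditive.sub_comp, Preadditive.comp_sub, Category.assoc, Category.id_comp] at this
    simp only [Preadditive.add_comp, Preadditive.comp_sub, Category.assoc, Category.id_comp,
      Category.comp_id]
    rw [← sub_eq_zero] at this ⊢
    rw [← this]; abel

lemma add {A B : C} {f f' : A ⟶ B} (hf : InRadical f) (hf' : InRadical f') :
    InRadical (f + f') := fun g => by
  have h1 := hf g
  have h2 := hf' (g ≫ inv (𝟙 A - f ≫ g))
  have : 𝟙 A - (f + f') ≫ g = (𝟙 A - f' ≫ g ≫ inv (𝟙 A - f ≫ g)) ≫ (𝟙 A - f ≫ g) := by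
    rw [Preadditive.sub_comp, Category.assoc, Category.assoc, IsIso.inv_hom_id]
    simp; abel
  rw [this]; infer_instance

lemma zero {A B : C} : InRadical (0 : A ⟶ B) := fun g => by
  simp only [zero_comp, sub_zero]; infer_instance

lemma sum {A B : C} {ι : Type*} (s : Finset ι) (f : ι → (A ⟶ B)) (hf : ∀ i, InRadical (f i)) :
    InRadical (∑ i ∈ s, f i) := by
  classical
  induction s using Finset.induction_on with
  | empty => rw [Finset.sum_empty]; exact zero
  | insert i s hi ih => rw [Finset.sum_insert hi]; exact (hf i).add ih

end InRadical

variable [HasFiniteBiproducts C] [HasBinaryBiproducts C]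

lemma isDirectSum_biprod (A D : C) :
    IsDirectSum (biprod.inl : A ⟶ A ⊞ D) biprod.snd biprod.fst biprod.inr :=
  ⟨by simp, by simp, by simp, by simp, by simp⟩

/-- The isomorphism of a direct sum with the biproduct. -/
noncomputable def IsDirectSum.iso {A B D : C} {q : A ⟶ B} {ρ : B ⟶ D} {p : B ⟶ A} {e : D ⟶ B}
    (h : IsDirectSum q ρ p e) : B ≅ A ⊞ D where
  hom := biprod.lift p ρ
  inv := biprod.desc q e
  hom_inv_id := by simp [h.total]
  inv_hom_id := by ext <;> simp [h.q_p, h.q_ρ, h.e_p, h.e_ρ]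

lemma isDirectSum_biproduct {ι : Type} [Finite ι] [DecidableEq ι] (Y : ι → C) (i : ι) :
    IsDirectSum (biproduct.fromSubtype Y (· ≠ i)) (biproduct.π Y i)
      (biproduct.toSubtype Y (· ≠ i)) (biproduct.ι Y i) where
  q_p := by simp
  e_ρ := by simp
  q_ρ := by simp
  e_p := by simp
  total := by
    rw [biproduct.toSubtype_fromSubtype]
    ext j k
    by_cases hj : j = i
    · subst hj
      simp
    · have h : biproduct.ι Y i ≫ biproduct.π Y j = 0 := biproduct.ι_π_ne _ (Ne.symm hj)
      simp [h, hj]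

lemma isZero_biproduct_of_isEmpty {ι : Type} [IsEmpty ι] (Y : ι → C) : IsZero (⨁ Y) := by
  rw [IsZero.iff_id_eq_zero]
  ext i
  exact isEmptyElim i

lemma biproduct_induction (Q : ObjectProperty C) (h₀ : ∀ Z, IsZero Z → Q Z)
    (h₁ : ∀ {A B D : C} (q : A ⟶ B) (ρ : B ⟶ D) (p : B ⟶ A) (e : D ⟶ B),
      IsDirectSum q ρ p e → Q A → Q D → Q B)
    {ι : Type} [Finite ι] (Y : ι → C) (hY : ∀ i, Q (Y i)) : Q (⨁ Y) := by
  classical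
  have key : ∀ (n : ℕ) (ι : Type) [Finite ι] (Y : ι → C), Nat.card ι = n → (∀ i, Q (Y i)) →
      Q (⨁ Y) := by
    intro n
    induction n with
    | zero =>
      intro ι _ Y hn _
      have : IsEmpty ι := by
        rcases Nat.card_eq_zero.1 hn with h | h
        · exact h
        · exact (not_finite ι).elim
      exact h₀ _ (isZero_biproduct_of_isEmpty Y)
    | succ n ih =>
      intro ι _ Y hn hY
      have : Nonempty ι := (Nat.card_pos_iff.1 (by omega)).1
      obtain ⟨i⟩ := this
      refine h₁ _ _ _ _ (isDirectSum_biproduct Y i) (ih {j // j ≠ i} _ ?_ fun j => hY j) (hY i)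
      have := Fintype.ofFinite ι
      rw [Nat.card_eq_fintype_card] at hn ⊢
      rw [Fintype.card_subtype_compl, Fintype.card_subtype_eq]; omega
  exact key _ ι Y rfl hY

/-- `W` is a direct sum of `n` objects with local endomorphism rings. -/
def HasLocalDecomposition (n : ℕ) (W : C) : Prop :=
  ∃ (ι : Type) (_ : Finite ι) (Y : ι → C), Nat.card ι = n ∧ (∀ i, IsLocalObject (Y i)) ∧
    Nonempty (W ≅ ⨁ Y)

lemma IsKrullSchmidt.hasLocalDecomposition (hKS : IsKrullSchmidt C) (W : C) :
    ∃ n, HasLocalDecomposition n W := by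
  obtain ⟨n, Y, hY, hW⟩ := hKS W
  exact ⟨n, Fin n, inferInstance, Y, by simp, fun i => isLocalObject_of_isLocalRing (hY i), hW⟩

lemma HasLocalDecomposition.of_iso {n : ℕ} {W W' : C} (h : HasLocalDecomposition n W)
    (e : W ≅ W') : HasLocalDecomposition n W' := by
  obtain ⟨ι, h1, Y, h2, h3, ⟨e'⟩⟩ := h
  exact ⟨ι, h1, Y, h2, h3, ⟨e.symm ≪≫ e'⟩⟩

lemma HasLocalDecomposition.isZero {W : C} (h : HasLocalDecomposition 0 W) : IsZero W := by
  obtain ⟨ι, h1, Y, h2, h3, ⟨e⟩⟩ := h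
  have : IsEmpty ι := by
    rcases Nat.card_eq_zero.1 h2 with h | h
    · exact h
    · exact (not_finite ι).elim
  exact (isZero_biproduct_of_isEmpty Y).of_iso e

lemma HasLocalDecomposition.exists_isDirectSum {n : ℕ} {ι : Type} [Finite ι] [DecidableEq ι]
    {Y : ι → C} (hn : Nat.card ι = n) (hY : ∀ i, IsLocalObject (Y i)) (i : ι) :
    ∃ m, n = m + 1 ∧ HasLocalDecomposition m (⨁ Subtype.restrict (· ≠ i) Y) := by
  have : Nonempty ι := ⟨i⟩
  have hpos : 0 < Nat.card ι := Nat.card_pos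
  refine ⟨n - 1, by omega, {j // j ≠ i}, inferInstance, _, ?_, fun j => hY j, ⟨Iso.refl _⟩⟩
  have := Fintype.ofFinite ι
  rw [Nat.card_eq_fintype_card] at hn ⊢
  rw [Fintype.card_subtype_compl, Fintype.card_subtype_eq]; omega

lemma IsLocalObject.exists_isIso_π {ι : Type} [Finite ι] {Y : ι → C}
    (hY : ∀ i, IsLocalObject (Y i)) {Z : C} (hZ : IsLocalObject Z) {i : Z ⟶ ⨁ Y} {r : ⨁ Y ⟶ Z}
    (hir : i ≫ r = 𝟙 Z) : ∃ k, IsIso (i ≫ biproduct.π Y k) := by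
  have := Fintype.ofFinite ι
  obtain ⟨k, hk⟩ := hZ.exists_isIso Finset.univ
    (fun k => (i ≫ biproduct.π Y k) ≫ biproduct.ι Y k ≫ r) (by
      have : ∑ k, (i ≫ biproduct.π Y k) ≫ biproduct.ι Y k ≫ r = 𝟙 Z := by
        rw [← hir]
        conv_rhs => rw [← Category.id_comp r, ← biproduct.total]
        simp only [Preadditive.comp_sum, Preadditive.sum_comp, Category.assoc]
      rw [this]; infer_instance)
  exact ⟨k, hZ.isIso_of_comp (hY k) _ (biproduct.ι Y k ≫ r)⟩

/-- Removing a retract with local endomorphism ring from a sum of `n` such objects leaves a sum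
of `n - 1` such objects. -/
lemma HasLocalDecomposition.exists_complement {n : ℕ} {W Z : C} (hW : HasLocalDecomposition n W)
    (hZ : IsLocalObject Z) {i : Z ⟶ W} {r : W ⟶ Z} (hir : i ≫ r = 𝟙 Z) :
    ∃ (W' : C) (q : W' ⟶ W) (p : W ⟶ W'), IsDirectSum q r p i ∧
      ∃ m, n = m + 1 ∧ HasLocalDecomposition m W' := by
  classical
  obtain ⟨ι, _, Y, hn, hY, ⟨b⟩⟩ := hW
  obtain ⟨k, hk⟩ := IsLocalObject.exists_isIso_π hY hZ (i := i ≫ b.hom) (r := b.inv ≫ r)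
    (by simp [hir])
  have h := ((isDirectSum_biproduct Y k).complement (i := i ≫ b.hom) (r := b.inv ≫ r)
    (by simp [hir])).of_iso b.symm
  simp only [Iso.symm_inv, Iso.symm_hom, Iso.hom_inv_id_assoc, Category.assoc, Iso.hom_inv_id,
    Category.comp_id] at h
  exact ⟨_, _, _, h, HasLocalDecomposition.exists_isDirectSum hn hY k⟩

/-- In a Krull–Schmidt category every retract has a complement. -/
lemma IsKrullSchmidt.exists_complement (hKS : IsKrullSchmidt C) {Z W : C} {i : Z ⟶ W} {r : W ⟶ Z}
    (hir : i ≫ r = 𝟙 Z) : ∃ (W' : C) (q : W' ⟶ W) (p : W ⟶ W'), IsDirectSum q r p i := by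
  classical
  obtain ⟨n, hn⟩ := hKS.hasLocalDecomposition Z
  induction n generalizing Z W with
  | zero =>
    have hZ := hn.isZero
    exact ⟨W, 𝟙 W, 𝟙 W, by simp, hir, hZ.eq_of_tgt _ _, hZ.eq_of_src _ _, by
      rw [hZ.eq_of_src i 0]; simp⟩
  | succ n ih =>
    obtain ⟨ι, _, Y, hc, hY, ⟨b⟩⟩ := hn
    have : Nonempty ι := (Nat.card_pos_iff.1 (by omega)).1
    obtain ⟨k⟩ := this
    have hZ := (isDirectSum_biproduct Y k).of_iso b.symm
    obtain ⟨m, hm, hm'⟩ := HasLocalDecomposition.exists_isDirectSum hc hY k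
    obtain rfl : n = m := by omega
    obtain ⟨l, hl⟩ := hKS.hasLocalDecomposition W
    generalize hd : biproduct.ι Y k ≫ b.symm.hom = d at hZ
    generalize hb : b.symm.inv ≫ biproduct.π Y k = b' at hZ
    generalize ha : biproduct.fromSubtype Y (· ≠ k) ≫ b.symm.hom = a at hZ
    generalize hc : b.symm.inv ≫ biproduct.toSubtype Y (· ≠ k) = c at hZ
    obtain ⟨W₁, q₁, p₁, h₁, -⟩ := hl.exists_complement (hY k) (i := d ≫ i) (r := r ≫ b')
      (by simp [reassoc_of% hir, hZ.e_ρ])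
    have e3 : p₁ ≫ q₁ = 𝟙 W - r ≫ b' ≫ d ≫ i := by rw [← h₁.total]; simp
    obtain ⟨W₂, q₂, p₂, h₂⟩ := ih (Z := ⨁ Subtype.restrict (· ≠ k) Y) (W := W₁)
      (i := a ≫ i ≫ p₁) (r := q₁ ≫ r ≫ c) (by
        simp only [Category.assoc, reassoc_of% e3]
        simp [reassoc_of% hir, hZ.e_p, hZ.q_p]) hm'
    exact ⟨W₂, _, _, hZ.trans hir h₁ h₂⟩

/-- A morphism that is not right minimal kills a retract with local endomorphism ring. -/
lemma IsKrullSchmidt.exists_retract_of_not_isRightMinimal (hKS : IsKrullSchmidt C) {P M : C}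
    {α : P ⟶ M} (hα : ¬ IsRightMinimal α) :
    ∃ (Z : C) (i : Z ⟶ P) (r : P ⟶ Z), IsLocalObject Z ∧ i ≫ r = 𝟙 Z ∧ i ≫ α = 0 := by
  obtain ⟨n, ι, _, Y, -, hY, ⟨b⟩⟩ := hKS.hasLocalDecomposition P
  have := Fintype.ofFinite ι
  simp only [IsRightMinimal, not_forall] at hα
  obtain ⟨φ, hφα, hφ⟩ := hα
  have key : ∃ k l, ¬ InRadical
      (biproduct.ι Y k ≫ b.inv ≫ (𝟙 P - φ) ≫ b.hom ≫ biproduct.π Y l) := by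
    by_contra! hcon
    refine hφ ?_
    have h1 : InRadical (𝟙 P - φ) := by
      have h2 : 𝟙 P - φ = ∑ k, ∑ l, (b.hom ≫ biproduct.π Y k) ≫
          (biproduct.ι Y k ≫ b.inv ≫ (𝟙 P - φ) ≫ b.hom ≫ biproduct.π Y l) ≫
            biproduct.ι Y l ≫ b.inv := by
        have h3 : b.hom ≫ (∑ k, biproduct.π Y k ≫ biproduct.ι Y k) ≫ b.inv ≫ (𝟙 P - φ) ≫
            b.hom ≫ (∑ l, biproduct.π Y l ≫ biproduct.ι Y l) ≫ b.inv = 𝟙 P - φ := by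
          rw [biproduct.total]; simp
        conv_lhs => rw [← h3]
        simp only [Preadditive.sum_comp, Preadditive.comp_sum, Category.assoc]
        exact Finset.sum_comm
      rw [h2]
      exact InRadical.sum _ _ fun k => InRadical.sum _ _ fun l =>
        ((hcon k l).comp_right _).comp_left _
    simpa using h1 (𝟙 P)
  obtain ⟨k, l, hkl⟩ := key
  simp only [InRadical, not_forall] at hkl
  obtain ⟨g, hg⟩ := hkl
  set x := biproduct.ι Y k ≫ b.inv ≫ (𝟙 P - φ) ≫ b.hom ≫ biproduct.π Y l with hx
  have hiso : IsIso (x ≫ g) := ((hY k).2 (x ≫ g) (𝟙 _ - x ≫ g) (by simp)).resolve_right hg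
  refine ⟨Y k, biproduct.ι Y k ≫ b.inv ≫ (𝟙 P - φ),
    b.hom ≫ biproduct.π Y l ≫ g ≫ inv (x ≫ g), hY k, ?_, by simp [hφα]⟩
  have : (x ≫ g) ≫ inv (x ≫ g) = 𝟙 _ := IsIso.hom_inv_id _
  generalize inv (x ≫ g) = y at this ⊢
  rw [← this, hx]
  simp only [Category.assoc]

lemma IsKrullSchmidt.isLocalObject_of_indecomposable (hKS : IsKrullSchmidt C) {M : C}
    (hM : Indecomposable M) : IsLocalObject M := by
  classical
  obtain ⟨n, ι, _, Y, -, hY, ⟨b⟩⟩ := hKS.hasLocalDecomposition M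
  rcases isEmpty_or_nonempty ι with h | ⟨⟨k⟩⟩
  · exact (hM.1 ((isZero_biproduct_of_isEmpty Y).of_iso b)).elim
  · have h := (isDirectSum_biproduct Y k).of_iso b.symm
    rcases hM.2 _ _ h.iso with h' | h'
    · have := h.symm.isIso_left h'
      exact (hY k).of_iso (asIso (biproduct.ι Y k ≫ b.symm.hom))
    · exact ((hY k).1 h').elim

lemma addClosure_iff (hKS : IsKrullSchmidt C) {M Y : C} :
    addClosure M Y ↔ ∃ n : ℕ, Nonempty (Retract Y (⨁ fun _ : Fin n => M)) := by
  constructor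
  · rintro ⟨n, Z, ⟨b⟩⟩
    exact ⟨n, ⟨biprod.inl ≫ b.hom, b.inv ≫ biprod.fst, by simp⟩⟩
  · rintro ⟨n, ⟨r⟩⟩
    obtain ⟨W', q, p, h⟩ := hKS.exists_complement r.retract
    exact ⟨n, W', ⟨h.symm.iso.symm⟩⟩

lemma addClosure_self (M : C) : addClosure M M :=
  ⟨1, 0, ⟨(isDirectSum_biprod M 0).iso.symm ≪≫
    { hom := biprod.fst ≫ biproduct.lift fun _ => 𝟙 M
      inv := biproduct.π (fun _ : Fin 1 => M) 0 ≫ biprod.inl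
      hom_inv_id := by ext; simp
      inv_hom_id := by ext i j; fin_cases i; fin_cases j; simp }⟩⟩

lemma addClosure_of_isZero (M : C) {Z : C} (hZ : IsZero Z) : addClosure M Z :=
  ⟨0, 0, ⟨IsZero.iso (by rw [biprod_isZero_iff]; exact ⟨hZ, isZero_zero C⟩)
    (isZero_biproduct_of_isEmpty _)⟩⟩

lemma addClosure_retract (hKS : IsKrullSchmidt C) {M Y Z : C} (hY : addClosure M Y)
    (r : Retract Z Y) : addClosure M Z := by
  rw [addClosure_iff hKS] at hY ⊢
  obtain ⟨n, ⟨r'⟩⟩ := hY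
  exact ⟨n, ⟨r.trans r'⟩⟩

lemma addClosure_mono (hKS : IsKrullSchmidt C) {M M' : C} (r : Retract M M') :
    addClosure M ≤ addClosure M' := by
  intro Y hY
  rw [addClosure_iff hKS] at hY ⊢
  obtain ⟨n, ⟨r'⟩⟩ := hY
  refine ⟨n, ⟨r'.trans ⟨biproduct.map fun _ => r.i, biproduct.map fun _ => r.r, ?_⟩⟩⟩
  ext; simp

lemma addClosure_le (hKS : IsKrullSchmidt C) {M : C} (Q : ObjectProperty C) (hM : Q M)
    (h₀ : ∀ Z, IsZero Z → Q Z)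
    (h₁ : ∀ {A B D : C} (q : A ⟶ B) (ρ : B ⟶ D) (p : B ⟶ A) (e : D ⟶ B),
      IsDirectSum q ρ p e → Q A → Q D → Q B)
    (h₂ : ∀ {A B : C}, Retract A B → Q B → Q A) : addClosure M ≤ Q := by
  intro Y hY
  rw [addClosure_iff hKS] at hY
  obtain ⟨n, ⟨r⟩⟩ := hY
  exact h₂ r (biproduct_induction Q h₀ h₁ _ fun _ => hM)

/-- If `N` has a local endomorphism ring, the objects of `add N` are the sums of copies of `N`. -/
lemma IsLocalObject.addClosure_le {N : C} (hN : IsLocalObject N) (hKS : IsKrullSchmidt C)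
    (Q : ObjectProperty C) (hQ : ∀ {Y Z : C}, (Y ≅ Z) → Q Y → Q Z) (hM : Q N)
    (h₀ : ∀ Z, IsZero Z → Q Z)
    (h₁ : ∀ {A B D : C} (q : A ⟶ B) (ρ : B ⟶ D) (p : B ⟶ A) (e : D ⟶ B),
      IsDirectSum q ρ p e → Q A → Q D → Q B) : addClosure N ≤ Q := by
  classical
  intro Y hY
  rw [addClosure_iff hKS] at hY
  obtain ⟨n, ⟨r⟩⟩ := hY
  obtain ⟨m, ι, _, Z, -, hZ, ⟨b⟩⟩ := hKS.hasLocalDecomposition Y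
  refine hQ b.symm (biproduct_induction Q h₀ h₁ Z fun k => ?_)
  obtain ⟨l, hl⟩ := IsLocalObject.exists_isIso_π (fun _ => hN) (hZ k)
    (i := biproduct.ι Z k ≫ b.inv ≫ r.i) (r := r.r ≫ b.hom ≫ biproduct.π Z k) (by simp)
  exact hQ (asIso ((biproduct.ι Z k ≫ b.inv ≫ r.i) ≫ biproduct.π _ l)).symm hM

lemma addClosure_of_retract_biproduct (hKS : IsKrullSchmidt C) {M Y : C} {ι : Type} [Finite ι]
    (r : Retract Y (⨁ fun _ : ι => M)) : addClosure M Y := by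
  rw [addClosure_iff hKS]
  obtain ⟨n, ⟨e⟩⟩ := Finite.exists_equiv_fin ι
  let b : (⨁ fun _ : ι => M) ≅ ⨁ fun _ : Fin n => M := biproduct.whiskerEquiv e fun _ => Iso.refl M
  exact ⟨n, ⟨r.i ≫ b.hom, b.inv ≫ r.r, by simp⟩⟩

lemma addClosure_of_isDirectSum (hKS : IsKrullSchmidt C) {M A B D : C} {q : A ⟶ B} {ρ : B ⟶ D}
    {p : B ⟶ A} {e : D ⟶ B} (h : IsDirectSum q ρ p e) (hA : addClosure M A)
    (hD : addClosure M D) : addClosure M B := by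
  rw [addClosure_iff hKS] at hA hD
  obtain ⟨n, ⟨r⟩⟩ := hA
  obtain ⟨m, ⟨r'⟩⟩ := hD
  let Y : Fin n ⊕ Fin m → C := fun _ => M
  let a : (⨁ fun _ : Fin n => M) ⟶ ⨁ Y := biproduct.desc fun k => biproduct.ι Y (Sum.inl k)
  let a' : ⨁ Y ⟶ (⨁ fun _ : Fin n => M) := biproduct.lift fun k => biproduct.π Y (Sum.inl k)
  let b : (⨁ fun _ : Fin m => M) ⟶ ⨁ Y := biproduct.desc fun k => biproduct.ι Y (Sum.inr k)
  let b' : ⨁ Y ⟶ (⨁ fun _ : Fin m => M) := biproduct.lift fun k => biproduct.π Y (Sum.inr k)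
  have haa : a ≫ a' = 𝟙 _ := by
    ext j k
    by_cases h : j = k
    · subst h; simp [a, a']; rfl
    · simp only [a, a', biproduct.ι_desc_assoc, biproduct.lift_π, Category.assoc,
        Category.id_comp]
      rw [biproduct.ι_π_ne _ (Ne.symm h), biproduct.ι_π_ne _ (by simpa using Ne.symm h)]
  have hbb : b ≫ b' = 𝟙 _ := by
    ext j k
    by_cases h : j = k
    · subst h; simp [b, b']; rfl
    · simp only [b, b', biproduct.ι_desc_assoc, biproduct.lift_π, Category.assoc,
        Category.id_comp]
      rw [biproduct.ι_π_ne _ (Ne.symm h), biproduct.ι_π_ne _ (by simpa using Ne.symm h)]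
  have hab : a ≫ b' = 0 := by ext j k; simp [a, b']
  have hba : b ≫ a' = 0 := by ext j k; simp [b, a']
  refine addClosure_of_retract_biproduct hKS (ι := Fin n ⊕ Fin m)
    ⟨p ≫ r.i ≫ a + ρ ≫ r'.i ≫ b, a' ≫ r.r ≫ q + b' ≫ r'.r ≫ e, ?_⟩
  simp [reassoc_of% haa, reassoc_of% hab, reassoc_of% hba, reassoc_of% hbb, h.total]

end KrullSchmidt

end MixedStd

namespace MixedStd

open ZeroObject

section Filtrations

variable {𝕜 : Type z} [Field 𝕜] {C : Type u} [Category.{v} C] [Preadditive C]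
  [Linear 𝕜 C] [HasFiniteBiproducts C] [HasBinaryBiproducts C]

namespace ExtriangulatedCat

open ExtData

variable {X : ExtriangulatedCat.{v, u, w, z} 𝕜 C}

lemma star_mono {P P' Q Q' : ObjectProperty C} (h : P ≤ P') (h' : Q ≤ Q') :
    X.star P Q ≤ X.star P' Q' := by
  rintro M ⟨Y, Z, f, g, hY, hZ, hc⟩
  exact ⟨Y, Z, f, g, h _ hY, h' _ hZ, hc⟩

lemma star_assoc_le (P Q R : ObjectProperty C) :
    X.star (X.star P Q) R ≤ X.star P (X.star Q R) := by
  rintro M ⟨Y, Z, g, g', ⟨A, D, f, f', hA, hD, δ, h⟩, hZ, δ', h'⟩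
  obtain ⟨E, k, d, e, δ'', h₁, -, -, h₂, -, -⟩ := X.et4 h h'
  exact ⟨A, E, f ≫ g, k, hA, ⟨D, Z, d, e, hD, hZ, _, h₂⟩, _, h₁⟩

lemma star_filtPow_le (M : C) (l m : ℕ) :
    X.star (X.filtPow M l) (X.filtPow M m) ≤ X.filtPow M (l + m + 1) := by
  induction l with
  | zero => rw [zero_add]; exact le_rfl
  | succ l ih =>
    have : l + 1 + m + 1 = (l + m + 1) + 1 := by omega
    rw [this]
    exact (star_assoc_le _ _ _).trans (star_mono le_rfl ih)

lemma isExtensionClosed_filt (M : C) : X.IsExtensionClosed (X.Filt M) := by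
  rintro B ⟨Y, Z, f, g, ⟨l, hY⟩, ⟨m, hZ⟩, hc⟩
  exact ⟨_, star_filtPow_le M l m _ ⟨Y, Z, f, g, hY, hZ, hc⟩⟩

lemma addClosure_le_filt (M : C) : addClosure M ≤ X.Filt M := fun _ h => ⟨0, h⟩

lemma filt_le {M : C} {Q : ObjectProperty C} (h : addClosure M ≤ Q)
    (hQ : X.IsExtensionClosed Q) : X.Filt M ≤ Q := by
  rintro Y ⟨l, hY⟩
  induction l generalizing Y with
  | zero => exact h _ hY
  | succ l ih =>
    obtain ⟨A, D, f, g, hA, hD, hc⟩ := hY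
    exact hQ _ ⟨A, D, f, g, h _ hA, ih _ hD, hc⟩

lemma filt_mono (hKS : IsKrullSchmidt C) {M M' : C} (r : Retract M M') :
    X.Filt M ≤ X.Filt M' :=
  filt_le ((addClosure_mono hKS r).trans (addClosure_le_filt _)) (isExtensionClosed_filt _)

lemma filt_self (M : C) : X.Filt M M := addClosure_le_filt _ _ (addClosure_self M)

lemma filt_of_isZero (M : C) {Z : C} (hZ : IsZero Z) : X.Filt M Z :=
  addClosure_le_filt _ _ (addClosure_of_isZero M hZ)

/-- Membership in `𝓕(M)` implies every property of `M` that is inherited by retracts and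
extensions. -/
lemma filt_induction (hKS : IsKrullSchmidt C) {M : C} (Q : ObjectProperty C) (hM : Q M)
    (h₀ : ∀ Z, IsZero Z → Q Z) (h₁ : ∀ {A B : C}, Retract A B → Q B → Q A)
    (h₂ : ∀ {A B D : C} {δ : X.Ext D A} {f : A ⟶ B} {g : B ⟶ D}, X.Realizes δ f g →
      Q A → Q D → Q B) : X.Filt M ≤ Q :=
  filt_le (addClosure_le hKS Q hM h₀ (fun _ _ _ _ h => h₂ (realizes_zero_of_isDirectSum h)) h₁)
    (by rintro B ⟨A, D, f, g, hA, hD, δ, h⟩; exact h₂ h hA hD)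

lemma ext_filt_right (hKS : IsKrullSchmidt C) {M W : C} (h : Subsingleton (X.Ext W M)) {Y : C}
    (hY : X.Filt M Y) : Subsingleton (X.Ext W Y) :=
  filt_induction hKS (fun Y => Subsingleton (X.Ext W Y)) h
    (fun _ hZ => X.subsingleton_of_isZero_right hZ)
    (fun r _ => X.subsingleton_of_retract r) (fun h => ext_subsingleton_of_right h) _ hY

lemma ext_filt_left (hKS : IsKrullSchmidt C) {M W : C} (h : Subsingleton (X.Ext M W)) {Y : C}
    (hY : X.Filt M Y) : Subsingleton (X.Ext Y W) :=
  filt_induction hKS (fun Y => Subsingleton (X.Ext Y W)) h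
    (fun _ hZ => X.subsingleton_of_isZero_left hZ)
    (fun r _ => X.subsingleton_of_retract_left r) (fun h => ext_subsingleton_of_left h) _ hY

lemma hom_filt_right (hKS : IsKrullSchmidt C) {M W : C} (h : ∀ f : W ⟶ M, f = 0) {Y : C}
    (hY : X.Filt M Y) : ∀ f : W ⟶ Y, f = 0 :=
  filt_induction hKS (fun Y => ∀ f : W ⟶ Y, f = 0) h
    (fun _ hZ f => hZ.eq_of_tgt f 0)
    (fun r h f => by
      rw [← Category.comp_id f, ← r.retract, ← Category.assoc, h (f ≫ r.i), zero_comp])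
    (fun h hA hD f => by
      obtain ⟨a, rfl⟩ := exists_lift h f (hD _)
      rw [hA a, zero_comp]) _ hY

lemma hom_filt_left (hKS : IsKrullSchmidt C) {M W : C} (h : ∀ f : M ⟶ W, f = 0) {Y : C}
    (hY : X.Filt M Y) : ∀ f : Y ⟶ W, f = 0 :=
  filt_induction hKS (fun Y => ∀ f : Y ⟶ W, f = 0) h
    (fun _ hZ f => hZ.eq_of_src f 0)
    (fun r h f => by
      rw [← Category.id_comp f, ← r.retract, Category.assoc, h (r.r ≫ f), comp_zero])
    (fun h hA hD f => by
      obtain ⟨a, rfl⟩ := exists_desc h f (hA _)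
      rw [hD a, comp_zero]) _ hY

/-- A direct summand of the middle term of a conflation that lifts to the first term can be
removed from both. -/
lemma exists_conflation_of_summand (hKS : IsKrullSchmidt C) {A B D Y B' : C} {f : A ⟶ B}
    {g : B ⟶ D} (h : X.IsConflation f g) {i : Y ⟶ A} {q : B' ⟶ B} {ρ : B ⟶ Y} {p : B ⟶ B'}
    (hB : IsDirectSum q ρ p (i ≫ f)) :
    ∃ (A' : C) (f' : A' ⟶ B'), Nonempty (Retract A' A) ∧ X.IsConflation f' (q ≫ g) := by
  obtain ⟨δ, h⟩ := h
  obtain ⟨A', a, c, hA⟩ := hKS.exists_complement (i := i) (r := f ≫ ρ)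
    (by rw [← hB.e_ρ, Category.assoc])
  have hδ : X.push a (X.push c δ) = δ := by
    have : X.push (c ≫ a + (f ≫ ρ) ≫ i) δ = X.push (c ≫ a) δ := by
      rw [push_add, Category.assoc, push_comp (a := f), push_inflation h, map_zero, add_zero]
    rw [← push_comp, ← this, hA.total, push_id]
  obtain ⟨B₁, f₁, g₁, h₁⟩ := X.exists_realizes (X.push c δ)
  obtain ⟨b, hb, hb'⟩ := X.realize h₁ h a (𝟙 D) (by rw [hδ, pull_id])
  rw [Category.comp_id] at hb'
  have hY := X.realize_sum h₁ (realizes_id_left (X := X) (A := Y) (isZero_zero C))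
  have : IsIso (biprod.desc a i) := ⟨hA.iso.hom, hA.iso.inv_hom_id, hA.iso.hom_inv_id⟩
  have hfst : IsIso (biprod.fst : D ⊞ (0 : C) ⟶ D) :=
    ⟨biprod.inl, by ext; simp, by simp⟩
  have hfg := comp_eq_zero h
  have hiso := isIso_middle hY h (biprod.desc a i) (biprod.desc b (i ≫ f)) biprod.fst
    (by ext <;> simp [hb]) (by ext <;> simp [hb', hfg]) (by
      rw [directSum, map_zero, map_zero, add_zero, ← push_comp, biprod.inl_desc, push_pull, hδ])
  have hB₁ := (isDirectSum_biprod B₁ Y).of_iso (asIso (biprod.desc b (i ≫ f)))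
  simp only [asIso_hom, biprod.inr_desc, biprod.inl_desc] at hB₁
  obtain ⟨e, -, he⟩ := hB.exists_iso hB₁
  refine ⟨A', f₁ ≫ e.inv, ⟨⟨a, c, hA.q_p⟩⟩, X.push c δ, h₁.of_iso e.symm rfl ?_⟩
  have hpq : p ≫ q = 𝟙 B - ρ ≫ i ≫ f := by rw [← hB.total]; simp
  simp [he, reassoc_of% hpq, hb', hfg]

/-- Every deflation has a right minimal version. -/
lemma exists_isRightMinimal (hKS : IsKrullSchmidt C) {Q : ObjectProperty C}
    (hQ : ∀ {A B : C}, Retract A B → Q B → Q A) {K P M : C} {f : K ⟶ P} {α : P ⟶ M}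
    (hc : X.IsConflation f α) (hK : Q K) :
    ∃ (K' P' : C) (f' : K' ⟶ P') (α' : P' ⟶ M) (r : Retract P' P),
      X.IsConflation f' α' ∧ Q K' ∧ IsRightMinimal α' ∧ r.i ≫ α = α' ∧ r.r ≫ α' = α := by
  obtain ⟨n, hn⟩ := hKS.hasLocalDecomposition P
  induction n generalizing K P with
  | zero =>
    refine ⟨K, P, f, α, Retract.refl P, hc, hK, fun φ _ => ?_, by simp, by simp⟩
    exact ⟨0, hn.isZero.eq_of_src _ _, hn.isZero.eq_of_src _ _⟩
  | succ n ih =>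
    by_cases hα : IsRightMinimal α
    · exact ⟨K, P, f, α, Retract.refl P, hc, hK, hα, by simp, by simp⟩
    · obtain ⟨Z, i, r, hZ, hir, hi⟩ := hKS.exists_retract_of_not_isRightMinimal hα
      obtain ⟨P₁, q, p, h, m, hm, hP₁⟩ := hn.exists_complement hZ hir
      obtain rfl : n = m := by omega
      obtain ⟨j, rfl⟩ := exists_lift hc.choose_spec i hi
      obtain ⟨K₁, f₁, ⟨rK⟩, hc₁⟩ := exists_conflation_of_summand hKS hc h
      obtain ⟨K', P', f', α', r', h1, h2, h3, h4, h5⟩ := ih hc₁ (hQ rK hK) hP₁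
      refine ⟨K', P', f', α', r'.trans ⟨q, p, h.q_p⟩, h1, h2, h3, by simp [h4], ?_⟩
      have hpq : p ≫ q = 𝟙 P - r ≫ j ≫ f := by rw [← h.total]; simp
      simp only [Category.assoc] at hi
      simp [h5, reassoc_of% hpq, hi]

/-- Objects with a filtration of length `l` by copies of `N`. -/
def HasFiltration (X : ExtriangulatedCat.{v, u, w, z} 𝕜 C) (N : C) : ℕ → ObjectProperty C
  | 0 => fun Y => IsZero Y
  | l + 1 => fun Y => ∃ (Z : C) (f : N ⟶ Y) (g : Y ⟶ Z), X.IsConflation f g ∧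
      X.HasFiltration N l Z

lemma HasFiltration.of_iso {N : C} {l : ℕ} {Y Y' : C} (h : X.HasFiltration N l Y) (e : Y ≅ Y') :
    X.HasFiltration N l Y' := by
  cases l with
  | zero => exact IsZero.of_iso h e.symm
  | succ l =>
    obtain ⟨Z, f, g, ⟨δ, hc⟩, hZ⟩ := h
    exact ⟨Z, f ≫ e.hom, e.inv ≫ g, ⟨δ, hc.of_iso e rfl (by simp)⟩, hZ⟩

lemma HasFiltration.ext {N : C} {m l : ℕ} {A B D : C} (hA : X.HasFiltration N m A)
    (hD : X.HasFiltration N l D) {f : A ⟶ B} {g : B ⟶ D} (h : X.IsConflation f g) :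
    X.HasFiltration N (m + l) B := by
  obtain ⟨δ, h⟩ := h
  induction m generalizing A B D with
  | zero =>
    have := isIso_deflation h hA
    rw [zero_add]
    exact hD.of_iso (asIso g).symm
  | succ m ih =>
    obtain ⟨A', i, p, ⟨δ', h'⟩, hA'⟩ := hA
    obtain ⟨E, k, d, e, δ'', h₁, -, -, h₂, -, -⟩ := X.et4 h' h
    rw [Nat.add_right_comm]
    exact ⟨E, i ≫ f, k, ⟨_, h₁⟩, ih hA' hD _ h₂⟩

lemma hasFiltration_self (N : C) : X.HasFiltration N 1 N :=
  ⟨0, 𝟙 N, 0, ⟨_, realizes_id_left (isZero_zero C)⟩, isZero_zero C⟩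

lemma HasFiltration.filt {N : C} {l : ℕ} {Y : C} (h : X.HasFiltration N l Y) : X.Filt N Y := by
  induction l generalizing Y with
  | zero => exact filt_of_isZero N h
  | succ l ih =>
    obtain ⟨Z, f, g, hc, hZ⟩ := h
    exact isExtensionClosed_filt N _ ⟨N, Z, f, g, filt_self N, ih hZ, hc⟩

lemma exists_hasFiltration (hKS : IsKrullSchmidt C) {N : C} (hN : IsLocalObject N) {Y : C}
    (hY : X.Filt N Y) : ∃ l, X.HasFiltration N l Y :=
  filt_le (Q := fun Y => ∃ l, X.HasFiltration N l Y)
    (hN.addClosure_le hKS _ (fun e ⟨l, h⟩ => ⟨l, h.of_iso e⟩) ⟨1, hasFiltration_self N⟩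
      (fun _ hZ => ⟨0, hZ⟩)
      (fun _ _ _ _ h ⟨_, hA⟩ ⟨_, hD⟩ => ⟨_, hA.ext hD ⟨_, realizes_zero_of_isDirectSum h⟩⟩))
    (by rintro B ⟨A, D, f, g, ⟨_, hA⟩, ⟨_, hD⟩, hc⟩; exact ⟨_, hA.ext hD hc⟩) _ hY

/-- A nonzero map from an object filtered by a brick to the brick is a deflation. -/
lemma HasFiltration.exists_kernel {N : C} (hN : IsBrick N) {l : ℕ} {Y : C}
    (hY : X.HasFiltration N l Y) (g : Y ⟶ N) (hg : g ≠ 0) :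
    ∃ (m : ℕ) (K : C) (k : K ⟶ Y), l = m + 1 ∧ X.HasFiltration N m K ∧ X.IsConflation k g := by
  induction l generalizing Y with
  | zero => exact (hg (IsZero.eq_of_src hY _ _)).elim
  | succ l ih =>
    obtain ⟨Z, i, p, ⟨δ, h⟩, hZ⟩ := hY
    by_cases hi : i ≫ g = 0
    · obtain ⟨g', rfl⟩ := exists_desc h g hi
      have hg' : g' ≠ 0 := by rintro rfl; simp at hg
      obtain ⟨m, K, k, rfl, hK, δ', h'⟩ := ih hZ g' hg'
      obtain ⟨E, j, d, e, δ'', h₁, -, -, h₂, -, -⟩ := X.et4op h h'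
      exact ⟨m + 1, E, j, rfl, ⟨K, d, e, ⟨_, h₂⟩, hK⟩, _, h₁⟩
    · have : IsIso (i ≫ g) := (isUnit_iff_isIso (i ≫ g)).1 (hN.2 (i ≫ g) hi)
      have hδ : δ = 0 := by
        have : X.push (i ≫ g ≫ inv (i ≫ g)) δ = δ := by
          rw [← Category.assoc, IsIso.hom_inv_id, push_id]
        rw [← this, push_comp, push_inflation h, map_zero]
      obtain ⟨p', e, hs⟩ := exists_isDirectSum h hδ
      have hi' : (inv (i ≫ g) ≫ i) ≫ g = 𝟙 N := by rw [Category.assoc, IsIso.inv_hom_id]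
      have : IsIso ((inv (i ≫ g) ≫ i) ≫ p') := by
        rw [Category.assoc, hs.q_p]; infer_instance
      exact ⟨l, Z, _, rfl, hZ, _, realizes_zero_of_isDirectSum (hs.symm.complement hi')⟩

lemma HasFiltration.retract (hKS : IsKrullSchmidt C) {N : C} (hN : IsBrick N) {l : ℕ} {Y Z : C}
    (hY : X.HasFiltration N l Y) (r : Retract Z Y) : ∃ m, X.HasFiltration N m Z := by
  induction l generalizing Y Z with
  | zero =>
    refine ⟨0, ?_⟩
    change IsZero Z
    rw [IsZero.iff_id_eq_zero, ← r.retract, IsZero.eq_of_tgt hY r.i 0, zero_comp]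
  | succ l ih =>
    by_cases hZ : ∀ g : Z ⟶ N, g = 0
    · refine ⟨0, ?_⟩
      change IsZero Z
      rw [IsZero.iff_id_eq_zero, ← r.retract, hom_filt_right hKS hZ hY.filt r.i, zero_comp]
    · push Not at hZ
      obtain ⟨g, hg⟩ := hZ
      have hrg : r.r ≫ g ≠ 0 := fun h0 => hg (by
        rw [← Category.id_comp g, ← r.retract, Category.assoc, h0, comp_zero])
      obtain ⟨m, K, k, hm, hK, hc⟩ := hY.exists_kernel hN (r.r ≫ g) hrg
      obtain rfl : l = m := by omega
      obtain ⟨Z', q, p, h⟩ := hKS.exists_complement r.retract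
      obtain ⟨j, rfl⟩ := exists_lift hc.choose_spec q (by rw [reassoc_of% h.q_ρ, zero_comp])
      obtain ⟨K', f', ⟨rK⟩, hc'⟩ := exists_conflation_of_summand hKS hc h.symm
      obtain ⟨n, hn⟩ := ih hK rK
      exact ⟨_, hn.ext (hasFiltration_self N) hc'⟩

lemma filt_le_addClosure (hKS : IsKrullSchmidt C) {N : C} (hN : Subsingleton (X.Ext N N)) :
    X.Filt N ≤ addClosure N := by
  refine filt_le le_rfl ?_
  rintro B ⟨A, D, f, g, hA, hD, δ, h⟩
  have : Subsingleton (X.Ext D A) := ext_filt_left hKS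
    (ext_filt_right hKS hN (addClosure_le_filt _ _ hA)) (addClosure_le_filt _ _ hD)
  obtain ⟨p, e, hs⟩ := exists_isDirectSum h (Subsingleton.elim _ _)
  exact addClosure_of_isDirectSum hKS hs hA hD

/-- If `N` is a brick or a stone, `𝓕(N)` is closed under direct summands. -/
lemma filt_retract (hKS : IsKrullSchmidt C) {N : C} (hN : IsBrick N ∨ X.IsStone N) {Y Z : C}
    (r : Retract Z Y) (hY : X.Filt N Y) : X.Filt N Z := by
  rcases hN with hN | hN
  · obtain ⟨l, hl⟩ := exists_hasFiltration hKS hN.isLocalObject hY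
    obtain ⟨m, hm⟩ := hl.retract hKS hN r
    exact hm.filt
  · exact addClosure_le_filt _ _ (addClosure_retract hKS (filt_le_addClosure hKS hN.2 _ hY) r)

end ExtriangulatedCat

end Filtrations

end MixedStd

namespace MixedStd

section Approximations

variable {𝕜 : Type z} [Field 𝕜] {C : Type u} [Category.{v} C] [Preadditive C]
  [Linear 𝕜 C] [HasFiniteBiproducts C] [HasBinaryBiproducts C]

namespace NegExt

variable {X : ExtriangulatedCat.{v, u, w, z} 𝕜 C} (N : NegExt.{v, u, w, w', z} X)

lemma map_right_zero (Y : Cᵒᵖ) (A B : C) : (N.E.obj Y).map (0 : A ⟶ B) = 0 := by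
  simpa using N.map_right_add Y (0 : A ⟶ B) 0

lemma map_left_zero (A : C) (V W : C) : (N.E.map (0 : V ⟶ W).op).app A = 0 := by
  have h := N.map_left_add A (0 : V ⟶ W) 0
  rw [add_zero] at h
  exact left_eq_add.1 h

lemma subsingleton_right_of_retract {W A B : C} (r : Retract A B)
    [h : Subsingleton ((N.E.obj (op W)).obj B)] : Subsingleton ((N.E.obj (op W)).obj A) := by
  refine Function.Injective.subsingleton (f := ((N.E.obj (op W)).map r.i).hom) ?_
  refine Function.LeftInverse.injective (g := ((N.E.obj (op W)).map r.r).hom) fun x => ?_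
  rw [← AddCommGrpCat.comp_apply, ← Functor.map_comp, r.retract]
  simp

lemma subsingleton_left_of_retract {V W A : C} (r : Retract V W)
    [h : Subsingleton ((N.E.obj (op W)).obj A)] : Subsingleton ((N.E.obj (op V)).obj A) := by
  refine Function.Injective.subsingleton (f := ((N.E.map r.r.op).app A).hom) ?_
  refine Function.LeftInverse.injective (g := ((N.E.map r.i.op).app A).hom) fun x => ?_
  rw [← AddCommGrpCat.comp_apply, ← NatTrans.comp_app, ← Functor.map_comp, ← op_comp, r.retract]
  simp

lemma subsingleton_right_of_isZero {W A : C} (hA : IsZero A) :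
    Subsingleton ((N.E.obj (op W)).obj A) := by
  refine subsingleton_of_forall_eq 0 fun x => ?_
  have h : (N.E.obj (op W)).map (𝟙 A) = 0 := by rw [hA.eq_of_src (𝟙 A) 0, N.map_right_zero]
  rw [CategoryTheory.Functor.map_id] at h
  exact congrArg (fun k => k.hom x) h

lemma subsingleton_left_of_isZero {W A : C} (hW : IsZero W) :
    Subsingleton ((N.E.obj (op W)).obj A) := by
  refine subsingleton_of_forall_eq 0 fun x => ?_
  have h : (N.E.map (𝟙 W).op).app A = 0 := by rw [hW.eq_of_src (𝟙 W) 0, N.map_left_zero]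
  rw [op_id, CategoryTheory.Functor.map_id] at h
  exact congrArg (fun k => k.hom x) h

lemma subsingleton_right_of_realizes {A B D : C} {δ : X.Ext D A} {f : A ⟶ B} {g : B ⟶ D}
    (h : X.Realizes δ f g) {W : C} (hA : Subsingleton ((N.E.obj (op W)).obj A))
    (hD : Subsingleton ((N.E.obj (op W)).obj D)) : Subsingleton ((N.E.obj (op W)).obj B) := by
  refine subsingleton_of_forall_eq 0 fun x => ?_
  obtain ⟨y, rfl⟩ := ((N.lower_exact h W).1 x).1 (Subsingleton.elim _ _)
  rw [Subsingleton.elim y 0, map_zero]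

lemma subsingleton_left_of_realizes {A B D : C} {δ : X.Ext D A} {f : A ⟶ B} {g : B ⟶ D}
    (h : X.Realizes δ f g) {W : C} (hA : Subsingleton ((N.E.obj (op A)).obj W))
    (hD : Subsingleton ((N.E.obj (op D)).obj W)) : Subsingleton ((N.E.obj (op B)).obj W) := by
  refine subsingleton_of_forall_eq 0 fun x => ?_
  obtain ⟨y, rfl⟩ := ((N.upper_exact h W).1 x).1 (Subsingleton.elim _ _)
  rw [Subsingleton.elim y 0, map_zero]

lemma subsingleton_biproduct {ι κ : Type} [Finite ι] [Finite κ] {Y : ι → C} {Z : κ → C}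
    (h : ∀ i k, Subsingleton ((N.E.obj (op (Y i))).obj (Z k))) :
    Subsingleton ((N.E.obj (op (⨁ Y))).obj (⨁ Z)) :=
  biproduct_induction (fun V => Subsingleton ((N.E.obj (op V)).obj (⨁ Z)))
    (fun _ hV => N.subsingleton_left_of_isZero hV)
    (fun _ _ _ _ hs => N.subsingleton_left_of_realizes
      (ExtriangulatedCat.realizes_zero_of_isDirectSum hs)) Y fun i =>
    biproduct_induction (fun V => Subsingleton ((N.E.obj (op (Y i))).obj V))
      (fun _ hV => N.subsingleton_right_of_isZero hV)
      (fun _ _ _ _ hs => N.subsingleton_right_of_realizes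
        (ExtriangulatedCat.realizes_zero_of_isDirectSum hs)) Z (h i)

lemma subsingleton_filt (hKS : IsKrullSchmidt C) {M M' : C}
    (h : Subsingleton ((N.E.obj (op M)).obj M')) {Y Z : C} (hY : X.Filt M Y) (hZ : X.Filt M' Z) :
    Subsingleton ((N.E.obj (op Y)).obj Z) :=
  ExtriangulatedCat.filt_induction hKS (fun Y => Subsingleton ((N.E.obj (op Y)).obj Z))
    (ExtriangulatedCat.filt_induction hKS (fun Z => Subsingleton ((N.E.obj (op M)).obj Z)) h
      (fun _ hZ => N.subsingleton_right_of_isZero hZ)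
      (fun r _ => N.subsingleton_right_of_retract r)
      (fun h => N.subsingleton_right_of_realizes h) _ hZ)
    (fun _ hZ => N.subsingleton_left_of_isZero hZ)
    (fun r _ => N.subsingleton_left_of_retract r)
    (fun h => N.subsingleton_left_of_realizes h) _ hY

include N

/-- A composite of right minimal deflations with kernels `K₁` and `K₂` is right minimal if
`C(K₂, K₁) = 0` and `𝔼(P₂, K₂) = 0`. -/
lemma isRightMinimal_comp {K₁ K₂ P₁ P₂ M : C} {δ₁ : X.Ext M K₁} {f₁ : K₁ ⟶ P₁} {a₁ : P₁ ⟶ M}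
    {δ₂ : X.Ext P₁ K₂} {f₂ : K₂ ⟶ P₂} {a₂ : P₂ ⟶ P₁} (h₁ : X.Realizes δ₁ f₁ a₁)
    (h₂ : X.Realizes δ₂ f₂ a₂) (hHom : ∀ k : K₂ ⟶ K₁, k = 0) (hExt : Subsingleton (X.Ext P₂ K₂))
    (hm₁ : IsRightMinimal a₁) (hm₂ : IsRightMinimal a₂) : IsRightMinimal (a₂ ≫ a₁) := by
  intro φ hφ
  have hf : f₂ ≫ φ ≫ a₂ = 0 := by
    obtain ⟨k, hk⟩ := ExtriangulatedCat.exists_lift h₁ (f₂ ≫ φ ≫ a₂) (by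
      rw [Category.assoc, Category.assoc, hφ, ← Category.assoc,
        ExtriangulatedCat.comp_eq_zero h₂, zero_comp])
    rw [← hk, hHom k, zero_comp]
  obtain ⟨ψ, hψ⟩ := ExtriangulatedCat.exists_desc h₂ _ hf
  obtain ⟨ε, hε⟩ := ((N.upper_exact h₂ M).2.2 (ψ ≫ a₁ - a₁)).1 (by
    change a₂ ≫ (ψ ≫ a₁ - a₁) = 0
    rw [Preadditive.comp_sub, reassoc_of% hψ, hφ, sub_self])
  obtain ⟨ε', rfl⟩ := ((N.lower_exact h₁ K₂).2.1 ε).1 (hHom _)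
  have hε' : a₂ ≫ N.upper δ₂ P₁ ε' = 0 := ((N.upper_exact h₂ P₁).2.2 _).2 ⟨ε', rfl⟩
  rw [N.upper_nat] at hε
  have hiso : IsIso (ψ - N.upper δ₂ P₁ ε') := hm₁ _ (by rw [Preadditive.sub_comp, hε]; abel)
  have hψ' : φ ≫ a₂ = a₂ ≫ (ψ - N.upper δ₂ P₁ ε') := by
    rw [Preadditive.comp_sub, hε', sub_zero, hψ]
  generalize ψ - N.upper δ₂ P₁ ε' = θ at hiso hψ'
  obtain ⟨χ, hχ⟩ := ExtriangulatedCat.exists_lift_of_pull h₂ (a₂ ≫ inv θ) (Subsingleton.elim _ _)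
  have i₁ : IsIso (φ ≫ χ) := hm₂ _ (by rw [Category.assoc, hχ, reassoc_of% hψ']; simp)
  have i₂ : IsIso (χ ≫ φ) := hm₂ _ (by rw [Category.assoc, hψ', reassoc_of% hχ]; simp)
  have e₁ : φ ≫ χ ≫ inv (φ ≫ χ) = 𝟙 P₂ := by rw [← Category.assoc, IsIso.hom_inv_id]
  have e₂ : (inv (χ ≫ φ) ≫ χ) ≫ φ = 𝟙 P₂ := by rw [Category.assoc, IsIso.inv_hom_id]
  refine ⟨χ ≫ inv (φ ≫ χ), e₁, ?_⟩
  have : inv (χ ≫ φ) ≫ χ = χ ≫ inv (φ ≫ χ) := by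
    rw [← Category.comp_id (inv (χ ≫ φ) ≫ χ), ← e₁, ← Category.assoc _ φ, e₂, Category.id_comp]
  rw [← this]; exact e₂

/-- Let `K ⟶ P ⟶ M` be a conflation with right minimal deflation such that `𝔼⁻¹(K, M) = 0`, `M`
has a local endomorphism ring and every endomorphism of `P` induces an endomorphism of `M`.
Then `P` is indecomposable. -/
lemma indecomposable_of_isRightMinimal {K P M : C} {δ : X.Ext M K} {f : K ⟶ P} {α : P ⟶ M}
    (h : X.Realizes δ f α) (hα : IsRightMinimal α) (hM : IsLocalObject M)
    (hneg : Subsingleton ((N.E.obj (op K)).obj M))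
    (hEnd : ∀ e : P ⟶ P, ∃ u : M ⟶ M, α ≫ u = e ≫ α) : Indecomposable P := by
  have key : ∀ v : M ⟶ M, α ≫ v = 0 → v = 0 := by
    intro v hv
    obtain ⟨ε, rfl⟩ := ((N.upper_exact h M).2.2 v).1 hv
    rw [Subsingleton.elim ε 0, map_zero]
  refine ⟨fun hP => hM.1 ?_, fun Y Z b => ?_⟩
  · rw [IsZero.iff_id_eq_zero]
    exact key _ (hP.eq_of_src _ _)
  · obtain ⟨e, he⟩ : ∃ e : P ⟶ P, e = b.hom ≫ biprod.fst ≫ biprod.inl ≫ b.inv := ⟨_, rfl⟩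
    have hee : e ≫ e = e := by simp [he]
    obtain ⟨u, hu⟩ := hEnd e
    have huu : u ≫ u = u := by
      rw [← sub_eq_zero]
      exact key _ (by
        rw [Preadditive.comp_sub, reassoc_of% hu, hu, ← Category.assoc, hee, sub_self])
    rcases hM.2 u (𝟙 M - u) (by abel) with hi | hi
    · right
      have hu1 : u = 𝟙 M := by rw [← cancel_mono u, huu, Category.id_comp]
      rw [hu1, Category.comp_id] at hu
      have := hα e hu.symm
      have he1 : e = 𝟙 P := by rw [← cancel_mono e, hee, Category.id_comp]
      rw [IsZero.iff_id_eq_zero]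
      have : biprod.inr ≫ b.inv ≫ e ≫ b.hom ≫ biprod.snd = 𝟙 Z := by simp [he1]
      rw [← this, he]; simp
    · left
      have hu0 : u = 0 := by
        rw [← cancel_mono (𝟙 M - u), Preadditive.comp_sub, huu]; simp
      rw [hu0, comp_zero] at hu
      have := hα (𝟙 P - e) (by rw [Preadditive.sub_comp, ← hu]; simp)
      have he0 : e = 0 := by
        rw [← cancel_mono (𝟙 P - e), Preadditive.comp_sub, hee]; simp
      rw [IsZero.iff_id_eq_zero]
      have : biprod.inl ≫ b.inv ≫ e ≫ b.hom ≫ biprod.fst = 𝟙 Y := by simp [he]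
      rw [← this, he0]; simp

end NegExt

namespace ExtData

variable {X : ExtData.{v, u, w, z} 𝕜 C} {N M : C}

/-- A family with a `D_N`-basis of `𝔼(M, N)` as components generates `𝔼(M, N)`. -/
lemma IsDBasis.mem_of_closed {d : ℕ} {δ : Fin d → X.Ext M N} (h : X.IsDBasis δ)
    (S : Submodule 𝕜 (X.Ext M N)) (hS : ∀ (a : N ⟶ N), ∀ θ ∈ S, X.push a θ ∈ S)
    (hδ : ∀ i, δ i ∈ S) (θ : X.Ext M N) : θ ∈ S := by
  by_cases hN : IsBrick N
  · let := X.endModule M N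
    have hθ : θ ∈ Submodule.span (End N) (Set.range δ) := by rw [(h.1 hN).2]; trivial
    induction hθ using Submodule.span_induction with
    | mem x hx => obtain ⟨i, rfl⟩ := hx; exact hδ i
    | zero => exact S.zero_mem
    | add x y _ _ hx hy => exact S.add_mem hx hy
    | smul a x _ hx => exact hS a x hx
  · have hθ : θ ∈ Submodule.span 𝕜 (Set.range δ) := by rw [(h.2 hN).2]; trivial
    exact Submodule.span_le.2 (by rintro _ ⟨i, rfl⟩; exact hδ i) hθ

end ExtData

namespace ExtriangulatedCat

open ExtData

variable {X : ExtriangulatedCat.{v, u, w, z} 𝕜 C}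

lemma pull_of_isUniversalExtension {N M P : C} {g : P ⟶ M} (h : X.IsUniversalExtension N g)
    (θ : X.Ext M N) : X.pull g θ = 0 := by
  obtain ⟨d, δ, f, hr, hb⟩ := h
  refine hb.mem_of_closed (LinearMap.ker (X.pull g)) (fun a θ hθ => ?_) (fun i => ?_) θ
  · rw [LinearMap.mem_ker] at hθ ⊢
    rw [← push_pull, hθ, map_zero]
  · rw [LinearMap.mem_ker, ← push_pull, pull_deflation hr, map_zero]

lemma exists_desc_of_isUniversalExtension {N M P : C} {g : P ⟶ M}
    (h : X.IsUniversalExtension N g) (hN : IsBrick N) (k : P ⟶ N) : ∃ l : M ⟶ N, g ≫ l = k := by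
  obtain ⟨d, δ, f, hr, hb⟩ := h
  refine exists_desc hr k ?_
  let := X.endModule M N
  have hli := Fintype.linearIndependent_iff.1 (hb.1 hN).1
    (fun i => (biproduct.ι (fun _ : Fin d => N) i ≫ f ≫ k : N ⟶ N)) (by
      change ∑ i, X.push (biproduct.ι (fun _ : Fin d => N) i ≫ f ≫ k)
        (X.push (biproduct.π (fun _ : Fin d => N) i) δ) = 0
      simp only [← push_comp]
      rw [← push_sum]
      simp only [← Category.assoc]
      rw [← Preadditive.sum_comp, ← Preadditive.sum_comp, biproduct.total, Category.id_comp,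
        push_comp, push_inflation hr, map_zero])
  ext i
  rw [comp_zero]
  exact hli i

lemma filt_isZero_or (hKS : IsKrullSchmidt C) {ℰ : ObjectProperty C}
    [ℰ.IsClosedUnderIsomorphisms] (hext : X.IsExtensionClosed ℰ) {N : C} (hN : IsLocalObject N)
    (hℰ : ℰ N) : X.Filt N ≤ fun Y => IsZero Y ∨ ℰ Y := by
  have key : ∀ {A B D : C} {δ : X.Ext D A} {f : A ⟶ B} {g : B ⟶ D}, X.Realizes δ f g →
      (IsZero A ∨ ℰ A) → (IsZero D ∨ ℰ D) → (IsZero B ∨ ℰ B) := by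
    intro A B D δ f g h hA hD
    rcases hA with hA | hA
    · have := isIso_deflation h hA
      exact hD.imp (fun hD => hD.of_iso (asIso g)) (fun hD => ℰ.prop_of_iso (asIso g).symm hD)
    rcases hD with hD | hD
    · have := isIso_inflation h hD
      exact Or.inr (ℰ.prop_of_iso (asIso f) hA)
    · exact Or.inr (hext _ ⟨A, D, f, g, hA, hD, δ, h⟩)
  refine filt_le (hN.addClosure_le hKS _ (fun e h => ?_) (Or.inr hℰ) (fun _ => Or.inl)
    fun _ _ _ _ h => key (realizes_zero_of_isDirectSum h)) ?_
  · exact h.imp (fun h => h.of_iso e.symm) (fun h => ℰ.prop_of_iso e h)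
  · rintro B ⟨A, D, f, g, hA, hD, δ, h⟩
    exact key h hA hD

lemma prop_of_conflation (hKS : IsKrullSchmidt C) {ℰ : ObjectProperty C}
    [ℰ.IsClosedUnderIsomorphisms] (hext : X.IsExtensionClosed ℰ) {N : C} (hN : IsLocalObject N)
    (hℰ : ℰ N) {K P M : C} {f : K ⟶ P} {g : P ⟶ M} (h : X.IsConflation f g) (hK : X.Filt N K)
    (hM : ℰ M) : ℰ P := by
  rcases filt_isZero_or hKS hext hN hℰ _ hK with hZ | hK
  · have := isIso_deflation h.choose_spec hZ
    exact ℰ.prop_of_iso (asIso g).symm hM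
  · exact hext _ ⟨K, M, f, g, hK, hM, h⟩

lemma isConflation_zero_id {M Z : C} (hZ : IsZero Z) : X.IsConflation (0 : Z ⟶ M) (𝟙 M) :=
  ⟨0, realizes_id_right hZ⟩

/-- The kernel of a composite of deflations is an extension of their kernels. -/
lemma exists_conflation_comp {K₁ K₂ P₁ P₂ M : C} {f₁ : K₁ ⟶ P₁} {a₁ : P₁ ⟶ M} {f₂ : K₂ ⟶ P₂}
    {a₂ : P₂ ⟶ P₁} (h₁ : X.IsConflation f₁ a₁) (h₂ : X.IsConflation f₂ a₂) :
    ∃ (K : C) (f : K ⟶ P₂) (d : K₂ ⟶ K) (e : K ⟶ K₁),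
      X.IsConflation f (a₂ ≫ a₁) ∧ X.IsConflation d e := by
  obtain ⟨δ₁, h₁⟩ := h₁
  obtain ⟨δ₂, h₂⟩ := h₂
  obtain ⟨K, f, d, e, δ'', h, -, -, h', -, -⟩ := X.et4op h₂ h₁
  exact ⟨K, f, d, e, ⟨_, h⟩, ⟨_, h'⟩⟩

/-- Iterated universal extensions by `N` produce an object without extensions by `N`. -/
lemma exists_approximation (hKS : IsKrullSchmidt C) {ℰ : ObjectProperty C}
    [ℰ.IsClosedUnderIsomorphisms] (hext : X.IsExtensionClosed ℰ) {N : C} (hN : IsLocalObject N)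
    (hℰ : ℰ N) (huniv : X.AdmitsFiniteUniversalExtensions ℰ N) {M : C} (hM : ℰ M) :
    ∃ (K P : C) (f : K ⟶ P) (α : P ⟶ M), X.IsConflation f α ∧ X.Filt N K ∧ ℰ P ∧
      Subsingleton (X.Ext P N) ∧ (IsBrick N → ∀ k : P ⟶ N, ∃ l : M ⟶ N, α ≫ l = k) := by
  obtain ⟨P, a, rfl, ha, s, hs⟩ := huniv M hM
  have key : ∀ n, ∃ (K : C) (f : K ⟶ P n) (α : P n ⟶ P 0), X.IsConflation f α ∧ X.Filt N K ∧
      (IsBrick N → ∀ k : P n ⟶ N, ∃ l : P 0 ⟶ N, α ≫ l = k) := by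
    intro n
    induction n with
    | zero =>
      exact ⟨⨁ fun i : Fin 0 => N, 0, 𝟙 _, isConflation_zero_id (isZero_biproduct_of_isEmpty _),
        filt_of_isZero N (isZero_biproduct_of_isEmpty _), fun _ k => ⟨k, Category.id_comp k⟩⟩
    | succ n ih =>
      obtain ⟨K₁, f₁, α, h₁, hK₁, hb⟩ := ih
      obtain ⟨d, δ, f₂, h₂, -⟩ := id (ha n)
      obtain ⟨K, f, d, e, h, h'⟩ := exists_conflation_comp h₁ ⟨δ, h₂⟩
      refine ⟨K, f, _, h, isExtensionClosed_filt N _ ⟨_, _, d, e, ?_, hK₁, h'⟩, fun hN k => ?_⟩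
      · exact biproduct_induction (X.Filt N) (fun _ => filt_of_isZero N)
          (fun q ρ _ _ hs hA hD => isExtensionClosed_filt N _
            ⟨_, _, q, ρ, hA, hD, _, realizes_zero_of_isDirectSum hs⟩) _ fun _ => filt_self N
      · obtain ⟨l, rfl⟩ := exists_desc_of_isUniversalExtension (ha n) hN k
        obtain ⟨l', rfl⟩ := hb hN l
        exact ⟨l', by simp⟩
  obtain ⟨K, f, α, h, hK, hb⟩ := key s
  refine ⟨K, P s, f, α, h, hK, prop_of_conflation hKS hext hN hℰ h hK hM, ?_, hb⟩
  refine subsingleton_of_forall_eq 0 fun θ => ?_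
  rw [← X.pull_id θ, ← IsIso.inv_hom_id (a s), pull_comp,
    pull_of_isUniversalExtension (ha s), map_zero]

lemma isLocalObject_of_isBrick_or_isStone (hKS : IsKrullSchmidt C) {N : C}
    (hN : IsBrick N ∨ X.IsStone N) : IsLocalObject N :=
  hN.elim (fun h => h.isLocalObject) (fun h => hKS.isLocalObject_of_indecomposable h.1)

/-- If `N` is a brick or a stone, the approximation can be chosen right minimal. -/
lemma exists_minimal_approximation (hKS : IsKrullSchmidt C) {ℰ : ObjectProperty C}
    [ℰ.IsClosedUnderIsomorphisms] (hext : X.IsExtensionClosed ℰ) {N : C}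
    (hN : IsBrick N ∨ X.IsStone N) (hℰ : ℰ N) (huniv : X.AdmitsFiniteUniversalExtensions ℰ N)
    {M : C} (hM : ℰ M) :
    ∃ (K P : C) (f : K ⟶ P) (α : P ⟶ M), X.IsConflation f α ∧ IsRightMinimal α ∧ X.Filt N K ∧
      ℰ P ∧ Subsingleton (X.Ext P N) ∧ (IsBrick N → ∀ k : P ⟶ N, ∃ l : M ⟶ N, α ≫ l = k) := by
  have hloc := isLocalObject_of_isBrick_or_isStone hKS hN
  obtain ⟨K, P, f, α, h, hK, hP, hE, hb⟩ := exists_approximation hKS hext hloc hℰ huniv hM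
  obtain ⟨K', P', f', α', r, h', hK', hmin, hr, hr'⟩ :=
    exists_isRightMinimal hKS (Q := X.Filt N) (fun r hY => filt_retract hKS hN r hY) h hK
  refine ⟨K', P', f', α', h', hmin, hK', prop_of_conflation hKS hext hloc hℰ h' hK' hM,
    X.subsingleton_of_retract_left r, fun hN k => ?_⟩
  obtain ⟨l, hl⟩ := hb hN (r.r ≫ k)
  exact ⟨l, by rw [← hr, Category.assoc, hl, ← Category.assoc, r.retract, Category.id_comp]⟩

lemma ext_biproduct_right {ι : Type} [Finite ι] {Y : ι → C} {W : C}
    (h : ∀ i, Subsingleton (X.Ext W (Y i))) : Subsingleton (X.Ext W (⨁ Y)) :=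
  biproduct_induction (fun V => Subsingleton (X.Ext W V))
    (fun _ hV => X.subsingleton_of_isZero_right hV)
    (fun _ _ _ _ hs => ext_subsingleton_of_right (realizes_zero_of_isDirectSum hs)) Y h

lemma leftExtPerp_filt_iff (hKS : IsKrullSchmidt C) {t : ℕ} {Θ : Fin t → C} {P : C} :
    X.leftExtPerp (X.Filt (⨁ Θ)) P ↔ ∀ i, Subsingleton (X.Ext P (Θ i)) :=
  ⟨fun h i => h _ (filt_mono hKS ⟨biproduct.ι Θ i, biproduct.π Θ i, by simp⟩ _ (filt_self _)),
    fun h _ hY => ext_filt_right hKS (ext_biproduct_right h) hY⟩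

lemma filt_sumGE (hKS : IsKrullSchmidt C) {t : ℕ} (Θ : Fin t → C) {i j : Fin t} (h : j ≤ i) :
    X.Filt (Θ i) ≤ X.Filt (sumGE Θ j) :=
  filt_mono hKS ⟨biproduct.ι (fun k : {k : Fin t // j ≤ k} => Θ k.1) ⟨i, h⟩,
    biproduct.π (fun k : {k : Fin t // j ≤ k} => Θ k.1) ⟨i, h⟩, biproduct.ι_π_self _ _⟩

section MixedStandardizable

variable (N : NegExt.{v, u, w, w', z} X) (hKS : IsKrullSchmidt C) {t : ℕ} {Θ : Fin t → C}
  (ms1 : X.MS1 Θ) (ms2 : MS2 Θ) (ms3 : X.MS3 Θ) {ℰ : ObjectProperty C}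
  [ℰ.IsClosedUnderIsomorphisms] (hext : X.IsExtensionClosed ℰ) (hΘ : ∀ i, ℰ (Θ i))
  (huniv : ∀ i, X.AdmitsFiniteUniversalExtensions ℰ (Θ i))

include N hKS ms1 ms2 ms3 hext hΘ huniv

lemma exists_approximation_lt {M : C} (hM : ℰ M) {j : Fin t}
    (hj : ∀ i < j, Subsingleton (X.Ext M (Θ i))) (k : ℕ) (hjk : j.1 ≤ k) (hk : k ≤ t) :
    ∃ (K P : C) (f : K ⟶ P) (α : P ⟶ M), X.IsConflation f α ∧ IsRightMinimal α ∧ ℰ P ∧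
      X.Filt (sumGE Θ j) K ∧ (∀ i : Fin t, i.1 < k → Subsingleton (X.Ext P (Θ i))) ∧
      (∀ i : Fin t, k ≤ i.1 → ∀ h : Θ i ⟶ K, h = 0) ∧
      (IsBrick (Θ j) → ∀ h : P ⟶ Θ j, ∃ l : M ⟶ Θ j, α ≫ l = h) := by
  induction k, hjk using Nat.le_induction with
  | base =>
    have hZ := isZero_biproduct_of_isEmpty (fun _ : Fin 0 => M)
    exact ⟨_, M, 0, 𝟙 M, isConflation_zero_id hZ, fun φ hφ => by
      rw [Category.comp_id] at hφ; rw [hφ]; infer_instance, hM, filt_of_isZero _ hZ,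
      fun i hi => hj i hi, fun _ _ _ => hZ.eq_of_tgt _ _, fun _ h => ⟨h, Category.id_comp h⟩⟩
  | succ k hjk ih =>
    obtain ⟨K₁, P₁, f₁, α₁, h₁, hm₁, hP₁, hK₁, hE₁, hH₁, hb₁⟩ := ih (by omega)
    obtain ⟨i, rfl⟩ : ∃ i : Fin t, i.1 = k := ⟨⟨k, by omega⟩, rfl⟩
    obtain ⟨K₂, P₂, f₂, α₂, h₂, hm₂, hK₂, hP₂, hE₂, hb₂⟩ :=
      exists_minimal_approximation hKS hext (ms1 i) (hΘ i) (huniv i) hP₁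
    obtain ⟨K, f, d, e, h, h'⟩ := exists_conflation_comp h₁ h₂
    refine ⟨K, P₂, f, α₂ ≫ α₁, h, ?_, hP₂, ?_, fun l hl => ?_, fun l hl g => ?_, fun hN g => ?_⟩
    · exact N.isRightMinimal_comp h₁.choose_spec h₂.choose_spec
        (hom_filt_left hKS (hH₁ i le_rfl) hK₂) (ext_filt_right hKS hE₂ hK₂) hm₁ hm₂
    · exact isExtensionClosed_filt _ _
        ⟨K₂, K₁, d, e, filt_sumGE hKS Θ (show j ≤ i from hjk) _ hK₂, hK₁, h'⟩
    · rcases (Nat.lt_succ_iff_lt_or_eq.1 hl) with hl | hl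
      · exact ext_subsingleton_of_left h₂.choose_spec
          (ext_filt_left hKS (ms3 i l hl) hK₂) (hE₁ l hl)
      · obtain rfl : l = i := Fin.ext hl
        exact hE₂
    · obtain ⟨a, rfl⟩ := exists_lift h'.choose_spec g (hH₁ l (by omega) _)
      rw [hom_filt_right hKS (ms2 l i (show i.1 < l.1 by omega)) hK₂ a, zero_comp]
    · obtain ⟨g', rfl⟩ : ∃ g', α₂ ≫ g' = g := by
        rcases (show j ≤ i from hjk).eq_or_lt with hji | hji
        · subst hji
          exact hb₂ hN g
        · exact exists_desc h₂.choose_spec g (hom_filt_left hKS (ms2 i j hji) hK₂ _)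
      obtain ⟨l, rfl⟩ := hb₁ hN g'
      exact ⟨l, by simp⟩

lemma exists_filt_approximation {M : C} (hM : ℰ M) {j : Fin t} (hj : X.IsMinIndex Θ M j) :
    ∃ (K P : C) (f : K ⟶ P) (α : P ⟶ M), X.IsConflation f α ∧ IsRightMinimal α ∧ ℰ P ∧
      X.Filt (sumGE Θ j) K ∧ (∀ i : Fin t, Subsingleton (X.Ext P (Θ i))) ∧
      (IsBrick (Θ j) → ∀ h : P ⟶ Θ j, ∃ l : M ⟶ Θ j, α ≫ l = h) := by
  obtain ⟨K, P, f, α, h, hm, hP, hK, hE, -, hb⟩ :=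
    exists_approximation_lt N hKS ms1 ms2 ms3 hext hΘ huniv hM (j := j)
      (fun i hi => not_nontrivial_iff_subsingleton.1 fun hi' => (hj.2 hi').not_gt hi)
      t j.2.le le_rfl
  exact ⟨K, P, f, α, h, hm, hP, hK, fun i => hE i i.2, hb⟩

/-- If `M` is isomorphic to the brick `Θ(j)`, every morphism from a right minimal approximation
`α : P ⟶ M` to `M` factors through `α`. -/
lemma exists_comp_eq_of_isBrick {M : C} (hM : ℰ M) {j : Fin t} (hj : X.IsMinIndex Θ M j)
    (hbrick : IsBrick (Θ j)) (b : M ≅ Θ j) {K P : C} {f : K ⟶ P} {α : P ⟶ M}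
    (h : X.IsConflation f α) (hα : IsRightMinimal α)
    (hP : ∀ i, Subsingleton (X.Ext P (Θ i))) (hK : X.Filt (sumGE Θ j) K) (g : P ⟶ M) :
    ∃ u : M ⟶ M, α ≫ u = g := by
  obtain ⟨K₀, P₀, f₀, α₀, ⟨δ₀, h₀⟩, -, -, hK₀, hE₀, hb⟩ :=
    exists_filt_approximation N hKS ms1 ms2 ms3 hext hΘ huniv hM hj
  have hE : ∀ {W Y : C}, (∀ i, Subsingleton (X.Ext W (Θ i))) → X.Filt (sumGE Θ j) Y →
      Subsingleton (X.Ext W Y) := fun hW hY =>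
    ext_filt_right hKS (M := sumGE Θ j)
      (ext_biproduct_right (Y := fun i : {i : Fin t // j ≤ i} => Θ i.1) fun i => hW i.1) hY
  have := hE hP hK₀
  have := hE hE₀ hK
  obtain ⟨δ, h⟩ := h
  obtain ⟨p, hp⟩ := exists_lift_of_pull h₀ α (Subsingleton.elim _ _)
  obtain ⟨q, hq⟩ := exists_lift_of_pull h α₀ (Subsingleton.elim _ _)
  have hpq : (p ≫ q) ≫ α = α := by rw [Category.assoc, hq, hp]
  have := hα _ hpq
  obtain ⟨u, hu⟩ := hb hbrick (q ≫ g ≫ b.hom)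
  refine ⟨u ≫ b.inv, ?_⟩
  have hpq' : p ≫ q ≫ α = α := by rw [← Category.assoc, hpq]
  rw [← cancel_epi (p ≫ q), Category.assoc, reassoc_of% hpq', ← hp, Category.assoc,
    reassoc_of% hu]
  simp

end MixedStandardizable

end ExtriangulatedCat

end Approximations

end MixedStd

open MixedStd ExtriangulatedCat in
theorem proposition3p10 {𝕜 : Type z} [Field 𝕜] {C : Type u} [Category.{v} C]
    [Preadditive C] [Linear 𝕜 C]
    [HasFiniteBiproducts C] [HasBinaryBiproducts C]
    (hKS : MixedStd.IsKrullSchmidt C)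
    (X : MixedStd.ExtriangulatedCat.{v, u, w, z} 𝕜 C)
    (N : MixedStd.NegExt.{v, u, w, w', z} X)
    {t : ℕ} (Θ : Fin t → C)
    (ms1 : X.MS1 Θ) (ms2 : MixedStd.MS2 Θ) (ms3 : X.MS3 Θ)
    (ℰ : ObjectProperty C) [ℰ.IsClosedUnderIsomorphisms]
    (hfin : X.IsExtFinite ℰ) (hext : X.IsExtensionClosed ℰ)
    (hΘ : ∀ i, ℰ (Θ i))
    (huniv : ∀ i, X.AdmitsFiniteUniversalExtensions ℰ (Θ i)) :
    -- Part (1)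
    (∀ M, ℰ M → ∃ (K P : C) (f : K ⟶ P) (α : P ⟶ M),
      X.IsConflation f α ∧
      X.leftExtPerp (X.Filt (⨁ Θ)) P ∧ ℰ P ∧
      MixedStd.IsRightMinimal α ∧
      (X.leftExtPerp (X.Filt (⨁ Θ)) M → IsZero K) ∧
      (¬ X.leftExtPerp (X.Filt (⨁ Θ)) M →
        ∃ j, X.IsMinIndex Θ M j ∧ X.Filt (MixedStd.sumGE Θ j) K)) ∧
    -- Part (2), for every conflation as in Part (1)
    (N.MS4 Θ → ℰ = X.Filt (⨁ Θ) →
      ∀ M, ℰ M → ¬ X.leftExtPerp (X.Filt (⨁ Θ)) M → Indecomposable M →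
      ∀ j, X.IsMinIndex Θ M j →
        (MixedStd.rightHomPerp (X.Filt (MixedStd.sumGE Θ j)) M ∨
          MixedStd.addClosure (Θ j) M) →
      ∀ (K P : C) (f : K ⟶ P) (α : P ⟶ M),
        X.IsConflation f α →
        X.leftExtPerp (X.Filt (⨁ Θ)) P → ℰ P →
        MixedStd.IsRightMinimal α →
        X.Filt (MixedStd.sumGE Θ j) K →
        Indecomposable P) := by
  refine ⟨fun M hM => ?_, fun ms4 hℰ M hM _ hind j hj hcase K P f α h hP hℰP hα hK => ?_⟩
  · by_cases hperp : X.leftExtPerp (X.Filt (⨁ Θ)) M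
    · have hZ := isZero_biproduct_of_isEmpty (fun _ : Fin 0 => M)
      exact ⟨_, M, 0, 𝟙 M, isConflation_zero_id hZ, hperp, hM, fun φ hφ => by
        rw [Category.comp_id] at hφ; rw [hφ]; infer_instance, fun _ => hZ,
        fun h => (h hperp).elim⟩
    · have hne : {i : Fin t | Nontrivial (X.Ext M (Θ i))}.Nonempty := by
        by_contra hcon
        refine hperp ((leftExtPerp_filt_iff hKS).2 fun i => not_nontrivial_iff_subsingleton.1 ?_)
        exact fun hi => hcon ⟨i, hi⟩
      obtain ⟨j, hj, hmin⟩ := WellFounded.has_min (wellFounded_lt (α := Fin t)) _ hne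
      have hj' : X.IsMinIndex Θ M j := ⟨hj, fun i hi => not_lt.1 (hmin i hi)⟩
      obtain ⟨K, P, f, α, h, hα, hP, hK, hE, -⟩ :=
        exists_filt_approximation N hKS ms1 ms2 ms3 hext hΘ huniv hM hj'
      exact ⟨K, P, f, α, h, (leftExtPerp_filt_iff hKS).2 hE, hP, hα,
        fun hM => (hperp hM).elim, fun _ => ⟨j, hj', hK⟩⟩
  · have hloc := hKS.isLocalObject_of_indecomposable hind
    have hneg : Subsingleton ((N.E.obj (op K)).obj M) :=
      N.subsingleton_filt hKS (N.subsingleton_biproduct fun i k => ms4 i.1 k) hK (hℰ ▸ hM)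
    obtain ⟨δ, h⟩ := h
    refine N.indecomposable_of_isRightMinimal h hα hloc hneg fun e => ?_
    rcases hcase with hcase | hcase
    · exact exists_desc h _ (hcase K hK _)
    · obtain ⟨n, ⟨r⟩⟩ := (addClosure_iff hKS).1 hcase
      obtain ⟨k, hk⟩ := IsLocalObject.exists_isIso_π
        (fun _ => isLocalObject_of_isBrick_or_isStone hKS (ms1 j)) hloc r.retract
      let b : M ≅ Θ j := asIso (r.i ≫ biproduct.π (fun _ : Fin n => Θ j) k)
      have hbrick : IsBrick (Θ j) := (ms1 j).resolve_right fun hs => by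
        have := hs.2
        exact not_nontrivial_iff_subsingleton.2
          (X.subsingleton_of_retract_left (A := Θ j) (Retract.ofIso b)) hj.1
      exact exists_comp_eq_of_isBrick N hKS ms1 ms2 ms3 hext hΘ huniv hM hj hbrick b ⟨δ, h⟩ hα
        ((leftExtPerp_filt_iff hKS).1 hP) hK _
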